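/- Let $N\ge 1$, $p\ge 0$ be integers, $L_1,\dots,L_p\ge 1$ numbers of ordinal levels, $p_K$ a probability mass function on $\{1,2,\dots\}$, $\gamma>0$, $a>0$, $\mu_0\in\mathbb R^p$, $b>2$, $D$ a symmetric positive definite $p\times p$ matrix and $q\in(0,1)$. For a graph $G$ on $\{1,\dots,p\}$ let $P_G$ be the cone of symmetric positive definite matrices with zero entries at the non-edges of $G$, let $d\Omega$ be Lebesgue measure in the free entries (diagonal entries and edges), and put $$I_G(b,D)=\int_{P_G}|\Omega|^{(b-2)/2}e^{-\frac12\operatorname{tr}(D\Omega)}\,d\Omega .$$ Write $p(z\mid\mu,\Omega)=(2\pi)^{-p/2}|\Omega|^{1/2}e^{-\frac12(z-\mu)'\Omega(z-\mu)}$. Consider the hierarchical model - $K\sim p_K$; $(\pi_1,\dots,\pi_K)\mid K\sim\mathrm{Dir}(\gamma,\dots,\gamma)$; given $K,\pi$, the labels $c_1,\dots,c_N$ are independent with $P(c_i=j)=\pi_j$, $j=1,\dots,K$; - independently for $j=1,\dots,K$: $P(G_j=G)=P(G)=q^{|E(G)|}(1-q)^{p(p-1)/2-|E(G)|}$; given $G_j$,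 $\Omega_j$ has density $I_{G_j}(b,D)^{-1}|\Omega|^{(b-2)/2}e^{-\frac12\operatorname{tr}(D\Omega)}$ on $P_{G_j}$; given $\Omega_j$, $\mu_j\sim\mathcal N(\mu_0,(a\Omega_j)^{-1})$; - independently of all these, thresholds $-\infty=\theta^{(j)}_0<\theta^{(j)}_1<\dots<\theta^{(j)}_{L_j}=+\infty$ ($j=1,\dots,p$) with the diffuse prior (density $1$ with respect to Lebesgue measure on the ordered finite thresholds; this may be improper); - given everything else, $z_1,\dots,z_N$ are independent, $z_i$ having density $p(\cdot\mid\mu_{c_i},\Omega_{c_i})$, and $x_{ij}\in\{1,\dots,L_j\}$ is the level with $z_{ij}\in[\theta^{(j)}_{x_{ij}-1},\theta^{(j)}_{x_{ij}})$. Fix $i\in\{1,\dots,N\}$, and regard labels as determined up to renaming: the other labels $c_{-i}=(c_j)_{j\ne i}$ are recorded as the partition of $\{1,\dots,N\}\setminus\{i\}$ into existing clusters $k$, with parameters $(\mu_k,\Omega_k,G_k)$. Let $t$ be the number of existing clusters and $N_{-i,k}$ the number of $j\ne i$ in cluster $k$. Integrating out $K$, $\pi$ and the parameters of all clusters that contain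 no individual $j\neq i$, the conditional law of the cluster of individual $i$ given the partition $c_{-i}$, the parameters of the existing clusters, $z_1,\dots,z_N$, the observations $x_1,\dots,x_N$ and the thresholds is, almost everywhere, $$P(c_i=k\mid c_{-i},\cdot)\propto\begin{cases}(N_{-i,k}+\gamma)\,p(z_i\mid\mu_k,\Omega_k)&\text{for an existing cluster }k,\\[2pt]\gamma\,\dfrac{V_N(t+1)}{V_N(t)}\,m(z_i)&\text{for a new cluster,}\end{cases}$$ the weights being normalised to sum to $1$ over the $t$ existing clusters and the one possibility "new cluster". Here $$V_N(t)=\sum_{k=1}^{\infty}\frac{k(k-1)\cdots(k-t+1)}{\gamma k(\gamma k+1)\cdots(\gamma k+N-1)}\,p_K(k),$$ $$m(z_i)=\Bigl(\sum_{G}P(G)\,\frac{I_G(b+1,D+B-A)}{I_G(b,D)}\Bigr)\frac1{(2\pi)^{p/2}}\Bigl(\frac a{a+1}\Bigr)^{p/2},$$ the sum running over all graphs on $\{1,\dots,p\}$, with $A=(a+1)^{-1}(z_i+a\mu_0)(z_i+a\mu_0)'$ and $B=z_iz_i'+a\mu_0\mu_0'$. (Since the joint measure may be infinite, the conditional law is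 meant as a disintegration of it: integrating any nonnegative measurable function of the conditioning data and of the cluster of $i$ against the joint measure gives the same value as first averaging it over the cluster of $i$ with the stated probabilities.) -/

import Mathlib

open MeasureTheory ProbabilityTheory Matrix
open scoped ENNReal

noncomputable section

namespace MFMPGM

/-! ### Gaussian law parametrised by its precision matrix -/

/-- Density at `z` of the `p`-variate normal law with mean `μ` and precision matrix `Ω`. -/
def normalDensity {p : ℕ} (μ : Fin p → ℝ) (Ω : Matrix (Fin p) (Fin p) ℝ) (z : Fin p → ℝ) : ℝ :=
  Ω.det ^ (1 / 2 : ℝ) / (2 * Real.pi) ^ ((p : ℝ) / 2) *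
    Real.exp (-(1 / 2) * ((z - μ) ⬝ᵥ (Ω *ᵥ (z - μ))))

/-! ### G-Wishart law -/

/-- The free entries of a symmetric matrix with sparsity pattern `G`: the diagonal and the edges
of `G` (unordered pairs, so that each symmetric pair of entries is counted once). -/
abbrev FreeEntry {p : ℕ} (G : SimpleGraph (Fin p)) : Type :=
  {e : Sym2 (Fin p) // e.IsDiag ∨ e ∈ G.edgeSet}

instance {p : ℕ} (G : SimpleGraph (Fin p)) : Fintype (FreeEntry G) := Fintype.ofFinite _

open Classical in
/-- The symmetric matrix with given free entries and with zeros at the non-edges of `G`. -/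
def symmOfFree {p : ℕ} (G : SimpleGraph (Fin p)) (x : FreeEntry G → ℝ) :
    Matrix (Fin p) (Fin p) ℝ :=
  Matrix.of fun i j => if h : s(i, j).IsDiag ∨ s(i, j) ∈ G.edgeSet then x ⟨s(i, j), h⟩ else 0

/-- Product sigma-algebra on matrices. -/
instance matrixMeasurableSpace {p : ℕ} : MeasurableSpace (Matrix (Fin p) (Fin p) ℝ) :=
  inferInstanceAs (MeasurableSpace (Fin p → Fin p → ℝ))

/-- Lebesgue measure (in the free entries) on the cone of positive definite matrices `Ω` with
`Ω i j = 0` whenever `i ≠ j` are not adjacent in `G`. -/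
def coneMeasure {p : ℕ} (G : SimpleGraph (Fin p)) : Measure (Matrix (Fin p) (Fin p) ℝ) :=
  ((volume : Measure (FreeEntry G → ℝ)).map (symmOfFree G)).restrict {Ω | Ω.PosDef}

/-- Unnormalised G-Wishart density `|Ω|^((b-2)/2) exp(-tr(DΩ)/2)`. -/
def wishartKernel {p : ℕ} (b : ℝ) (D Ω : Matrix (Fin p) (Fin p) ℝ) : ℝ :=
  Ω.det ^ ((b - 2) / 2) * Real.exp (-(1 / 2) * (D * Ω).trace)

/-- Normalising constant `I_G(b, D)` of the G-Wishart law. -/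
def wishartConst {p : ℕ} (G : SimpleGraph (Fin p)) (b : ℝ) (D : Matrix (Fin p) (Fin p) ℝ) : ℝ :=
  ∫ Ω, wishartKernel b D Ω ∂(coneMeasure G)

/-- The G-Wishart law `W_G(b, D)`. -/
def gWishart {p : ℕ} (G : SimpleGraph (Fin p)) (b : ℝ) (D : Matrix (Fin p) (Fin p) ℝ) :
    Measure (Matrix (Fin p) (Fin p) ℝ) :=
  (coneMeasure G).withDensity fun Ω =>
    ENNReal.ofReal ((wishartConst G b D)⁻¹ * wishartKernel b D Ω)

/-! ### Prior of the parameters of one cluster -/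

/-- Independent Bernoulli(`q`) edges: `P(G) = q^|E| (1-q)^(p(p-1)/2 - |E|)`. -/
def graphPrior {p : ℕ} (q : ℝ) (G : SimpleGraph (Fin p)) : ℝ :=
  q ^ G.edgeSet.ncard * (1 - q) ^ (p.choose 2 - G.edgeSet.ncard)

/-- Parameters `(G, Ω, μ)` of one cluster. -/
abbrev ClusterParam (p : ℕ) : Type :=
  SimpleGraph (Fin p) × Matrix (Fin p) (Fin p) ℝ × (Fin p → ℝ)

/-- Hyperparameters: the p.m.f. `pK` of the number `K` of clusters, the Dirichlet parameter `γ`,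
the parameters `a`, `μ₀` of the normal prior of the means, the parameters `b`, `D` of the
G-Wishart prior and the edge probability `q`. -/
structure Hyper (p : ℕ) where
  pK : PMF ℕ+
  γ : ℝ
  a : ℝ
  μ₀ : Fin p → ℝ
  b : ℝ
  D : Matrix (Fin p) (Fin p) ℝ
  q : ℝ

/-- The range of the hyperparameters. -/
structure Hyper.Valid {p : ℕ} (H : Hyper p) : Prop where
  γ_pos : 0 < H.γ
  a_pos : 0 < H.a
  two_lt_b : 2 < H.b
  D_posDef : H.D.PosDef
  q_pos : 0 < H.q
  q_lt_one : H.q < 1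

/-- Law of `(G, Ω, μ)`: `G ∼ Bernoulli(q)` edgewise, `Ω ∣ G ∼ W_G(b, D)` and
`μ ∣ Ω ∼ N(μ₀, (aΩ)⁻¹)`. -/
def clusterPrior {p : ℕ} (H : Hyper p) : Measure (ClusterParam p) :=
  ∑ G : SimpleGraph (Fin p), ENNReal.ofReal (graphPrior H.q G) •
    (((gWishart G H.b H.D).prod (volume : Measure (Fin p → ℝ))).withDensity fun Ωμ =>
      ENNReal.ofReal (normalDensity H.μ₀ (H.a • Ωμ.1) Ωμ.2)).map (Prod.mk G)

/-! ### Mixture weights -/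

/-- The symmetric Dirichlet law `Dir(γ, …, γ)` on the simplex in `ℝ^K`: the law of
`(g₁, …, g_K) / (g₁ + ⋯ + g_K)` with `g₁, …, g_K` i.i.d. `Gamma(γ, 1)`. -/
def symmDirichlet (K : ℕ) (γ : ℝ) : Measure (Fin K → ℝ) :=
  (Measure.pi fun _ : Fin K => gammaMeasure γ 1).map fun g k => g k / ∑ l, g l

/-! ### Ordinal observations -/

/-- Finite thresholds `θ₁ < ⋯ < θ_{n-1}` of each variable; variable `j` has `L j` levels. -/
abbrev Thresholds {p : ℕ} (L : Fin p → ℕ) : Type := ∀ j, Fin (L j - 1) → ℝ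

/-- All the thresholds `-∞ = θ₀ < θ₁ < ⋯ < θ_{n-1} < θ_n = +∞` of a variable with `n` levels. -/
def cut {n : ℕ} (θ : Fin (n - 1) → ℝ) (m : ℕ) : EReal :=
  if m = 0 then ⊥ else if h : m - 1 < n - 1 then ((θ ⟨m - 1, h⟩ : ℝ) : EReal) else ⊤

/-- `z` lies in the hypercube `C(x, Θ)`. The level written `x j : Fin (L j)` is the level
`x j + 1` in `{1, …, L j}`. -/
def InCube {p : ℕ} {L : Fin p → ℕ} (θ : Thresholds L) (x : ∀ j, Fin (L j)) (z : Fin p → ℝ) :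
    Prop :=
  ∀ j, cut (θ j) (x j) ≤ (z j : EReal) ∧ (z j : EReal) < cut (θ j) (x j + 1)

/-- The diffuse prior of the thresholds: density `1` on the ordered thresholds. It is sigma-finite
and in general not finite. -/
def thresholdPrior {p : ℕ} (L : Fin p → ℕ) : Measure (Thresholds L) :=
  volume.restrict {θ | ∀ j, StrictMono (θ j)}

/-! ### The hierarchical model -/

/-- Latent variables of `N` individuals. -/
abbrev Latent (N p : ℕ) : Type := Fin N → Fin p → ℝ

/-- Ordinal observations of `N` individuals. -/
abbrev Obs (N : ℕ) {p : ℕ} (L : Fin p → ℕ) : Type := Fin N → ∀ j, Fin (L j)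

/-- The unknowns for a given number `K` of clusters, in the order: thresholds, mixture weights,
cluster labels, cluster parameters, latent variables, observations. -/
abbrev State (N : ℕ) {p : ℕ} (L : Fin p → ℕ) (K : ℕ) : Type :=
  Thresholds L × (Fin K → ℝ) × (Fin N → Fin K) × (Fin K → ClusterParam p) × Latent N p × Obs N L

open Classical in
/-- Density of labels, latent variables and observations given everything else:
`∏ᵢ π_{cᵢ} p(zᵢ ∣ μ_{cᵢ}, Ω_{cᵢ}) 1(zᵢ ∈ C(xᵢ, Θ))`. -/
def likelihood {N p : ℕ} {L : Fin p → ℕ} {K : ℕ} (ω : State N L K) : ℝ≥0∞ :=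
  match ω with
  | (θ, w, c, φ, z, x) => ∏ i, ENNReal.ofReal (w (c i)) *
      ENNReal.ofReal (normalDensity (φ (c i)).2.2 (φ (c i)).2.1 (z i)) *
      (if InCube θ (x i) (z i) then 1 else 0)

/-- The model given the number `K` of clusters. -/
def modelGiven (N : ℕ) {p : ℕ} (L : Fin p → ℕ) (H : Hyper p) (K : ℕ) : Measure (State N L K) :=
  ((thresholdPrior L).prod ((symmDirichlet K H.γ).prod (Measure.count.prod
    ((Measure.pi fun _ : Fin K => clusterPrior H).prod
      ((volume : Measure (Latent N p)).prod Measure.count))))).withDensity likelihood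

/-- The joint measure of the number `K` of clusters and of all the other unknowns. -/
def model (N : ℕ) {p : ℕ} (L : Fin p → ℕ) (H : Hyper p) : Measure (Σ K : ℕ+, State N L K) :=
  Measure.sum fun K : ℕ+ => H.pK K • (modelGiven N L H K).map (Sigma.mk K)

/-! ### Full conditional law of a cluster label, with `K` collapsed

Labels matter only up to renaming: once `K` is collapsed, the other labels `c_{-i}` are recorded
as the partition of the other individuals into clusters. -/

/-- The individuals other than `i`. -/
abbrev Others {N : ℕ} (i : Fin N) : Type := {j : Fin N // j ≠ i}

/-- The existing clusters of a partition `s` of the other individuals. -/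
abbrev Cluster {N : ℕ} {i : Fin N} (s : Setoid (Others i)) : Type := Quotient s

instance {N : ℕ} {i : Fin N} (s : Setoid (Others i)) : Fintype (Cluster s) := Fintype.ofFinite _

/-- What is conditioned upon, besides the partition `s` of the other individuals: the parameters
of the existing clusters, all latent variables, all observations and the thresholds. -/
abbrev Data (N : ℕ) {p : ℕ} (L : Fin p → ℕ) {i : Fin N} (s : Setoid (Others i)) : Type :=
  (Cluster s → ClusterParam p) × Latent N p × Obs N L × Thresholds L

variable {N p : ℕ} {L : Fin p → ℕ}

/-- The labels `c_{-i}`. -/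
def otherLabels (i : Fin N) (ω : Σ K : ℕ+, State N L K) : Others i → Fin ω.1 :=
  fun j => ω.2.2.2.1 j

/-- The partition of the other individuals given by their labels. -/
def partitionOf (i : Fin N) (ω : Σ K : ℕ+, State N L K) : Setoid (Others i) :=
  Setoid.ker (otherLabels i ω)

/-- The data conditioned upon; the parameters are those of the existing clusters only. -/
def dataOf (i : Fin N) (ω : Σ K : ℕ+, State N L K) : Data N L (partitionOf i ω) :=
  match ω with
  | ⟨K, (θ, w, c, φ, z, x)⟩ =>
      (fun k => φ (Setoid.kerLift (otherLabels i ⟨K, (θ, w, c, φ, z, x)⟩) k), z, x, θ)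

open Classical in
/-- The cluster of individual `i`: `some k` if it is the existing cluster `k`, and `none` if
its label differs from all the other labels, that is, if `i` is in a new cluster. -/
def choiceOf (i : Fin N) (ω : Σ K : ℕ+, State N L K) : Option (Cluster (partitionOf i ω)) :=
  if h : ∃ k : Cluster (partitionOf i ω), Setoid.kerLift (otherLabels i ω) k = ω.2.2.2.1 i
  then some h.choose else none

/-- `κ` is the conditional law, under the (possibly infinite) measure `M`, of the cluster of `i`
given the partition of the others, the parameters of their clusters, the latent variables, the
observations and the thresholds: `κ` is measurable, almost everywhere a probability vector, and
it disintegrates `M`. -/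
def IsFullConditional (i : Fin N) (M : Measure (Σ K : ℕ+, State N L K))
    (κ : ∀ s : Setoid (Others i), Data N L s → Option (Cluster s) → ℝ≥0∞) : Prop :=
  (∀ s k, Measurable fun d => κ s d k) ∧
  (∀ᵐ ω ∂M, ∑ k, κ (partitionOf i ω) (dataOf i ω) k = 1) ∧
  ∀ f : ∀ s : Setoid (Others i), Option (Cluster s) → Data N L s → ℝ≥0∞,
    (∀ s k, Measurable (f s k)) →
    ∫⁻ ω, f (partitionOf i ω) (choiceOf i ω) (dataOf i ω) ∂M =
      ∫⁻ ω, ∑ k, κ (partitionOf i ω) (dataOf i ω) k * f (partitionOf i ω) k (dataOf i ω) ∂M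

/-! ### The formula -/

/-- `V_N(t) = ∑_{k ≥ 1} k (k-1) ⋯ (k-t+1) / (γk (γk+1) ⋯ (γk+N-1)) p(k)`. -/
def V (pK : PMF ℕ+) (γ : ℝ) (N t : ℕ) : ℝ :=
  ∑' k : ℕ+, ((k : ℕ).descFactorial t : ℝ) / (∏ m ∈ Finset.range N, (γ * ((k : ℕ) : ℝ) + m)) *
    (pK k).toReal

/-- `A = (a+1)⁻¹ (z + aμ₀)(z + aμ₀)ᵀ`. -/
def matA (H : Hyper p) (z : Fin p → ℝ) : Matrix (Fin p) (Fin p) ℝ :=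
  (H.a + 1)⁻¹ • vecMulVec (z + H.a • H.μ₀) (z + H.a • H.μ₀)

/-- `B = z zᵀ + a μ₀ μ₀ᵀ`. -/
def matB (H : Hyper p) (z : Fin p → ℝ) : Matrix (Fin p) (Fin p) ℝ :=
  vecMulVec z z + H.a • vecMulVec H.μ₀ H.μ₀

/-- `m(z) = (∑_G P(G) I_G(b+1, D+B-A) / I_G(b, D)) (2π)^(-p/2) (a/(a+1))^(p/2)`. -/
def mNew (H : Hyper p) (z : Fin p → ℝ) : ℝ :=
  (∑ G : SimpleGraph (Fin p), graphPrior H.q G *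
      (wishartConst G (H.b + 1) (H.D + matB H z - matA H z) / wishartConst G H.b H.D)) *
    (1 / (2 * Real.pi) ^ ((p : ℝ) / 2)) * (H.a / (H.a + 1)) ^ ((p : ℝ) / 2)

/-- `N_{-i,k}`: the number of individuals other than `i` in the cluster `k`. -/
def clusterSize {i : Fin N} {s : Setoid (Others i)} (k : Cluster s) : ℕ :=
  {j : Others i | (Quotient.mk s j : Cluster s) = k}.ncard

/-- The unnormalised weights: `(N_{-i,k} + γ) p(zᵢ ∣ μ_k, Ω_k)` for an existing cluster `k` and
`γ V_N(t+1) / V_N(t) m(zᵢ)` for a new cluster, with `t` the number of existing clusters. -/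
def weight (H : Hyper p) (i : Fin N) (s : Setoid (Others i)) (d : Data N L s) :
    Option (Cluster s) → ℝ
  | some k => ((clusterSize k : ℝ) + H.γ) * normalDensity (d.1 k).2.2 (d.1 k).2.1 (d.2.1 i)
  | none => H.γ * (V H.pK H.γ N (Fintype.card (Cluster s) + 1) /
      V H.pK H.γ N (Fintype.card (Cluster s))) * mNew H (d.2.1 i)

end MFMPGM

end

/-! The theorem follows from one formula for the joint measure of the partition `s` of the others,
the choice `o` of individual `i` and the data, `lintegral_model`. Apart from a factor that does not
involve `o`, it gives `o` the mass `jointWeight`, and the conditional law is `jointWeight`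
normalised over the finitely many `o`. Only integrals of nonnegative functions occur, so the
possibly infinite total mass is harmless.

For fixed K, integrating out the Dirichlet weights gives a label vector the mass ∏_l
γ(γ+1)⋯(γ+n_l-1) / (γK(γK+1)⋯(γK+N-1)), where n_l counts label l (`lintegral_symmDirichlet`). Taking
`i` out of the numerator splits off γ + n, with n the number of others sharing its label
(`labelWeight_eq_mul`): this is N_{-i,k} + γ for an existing cluster and γ for a new one. The mass
depends on the labels only through the partition. A partition of the others with t blocks arises
from K(K-1)⋯(K-t+1) labellings, and a new cluster leaves K-t labels for `i`, which turns t into t+1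
(`sum_ker`, `sum_choiceOfLabel`). Averaging over K produces V_N(t) or V_N(t+1)
(`tsum_descFactorial_div_rising`).

The cluster parameters are i.i.d. with a probability law, so those of empty clusters integrate to 1,
while a cluster containing only `i` contributes the marginal density m(z_i) (`lintegral_parameters`,
`lintegral_normalDensity_clusterPrior`). Completing the square in μ removes the mean and leaves a
G-Wishart kernel with parameters b+1 and D+B-A. This requires that the constants I_G be finite and
positive.

Finally `jointWeight` is `weight` times a factor independent of `o` as long as V_N(t) > 0; if V_N(t)
= 0, all joint weights vanish, so such partitions carry no mass and the value of the quotient there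
is irrelevant. -/

noncomputable section

namespace MFMPGM

/-! ### Positive semidefinite matrices -/

section Matrices

variable {n : Type*} [Fintype n] [DecidableEq n]

open scoped MatrixOrder in
lemma exists_posSemidef_sub_smul_one {D : Matrix n n ℝ} (hD : D.PosDef) :
    ∃ r : ℝ, 0 < r ∧ (D - r • (1 : Matrix n n ℝ)).PosSemidef := by
  cases isEmpty_or_nonempty n
  · refine ⟨1, one_pos, ?_⟩
    rw [Subsingleton.elim (D - (1 : ℝ) • (1 : Matrix n n ℝ)) 0]
    exact Matrix.PosSemidef.zero
  · obtain ⟨r, hr, h⟩ := (CFC.exists_pos_algebraMap_le_iff (a := D) hD.isHermitian).2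
      fun x hx ↦ hD.isStrictlyPositive.spectrum_pos hx
    refine ⟨r, hr, ?_⟩
    rw [Matrix.le_iff, Algebra.algebraMap_eq_smul_one] at h
    exact h

open scoped MatrixOrder in
lemma trace_mul_nonneg {A B : Matrix n n ℝ} (hA : A.PosSemidef) (hB : B.PosSemidef) :
    0 ≤ (A * B).trace := by
  obtain ⟨y, rfl⟩ := CStarAlgebra.nonneg_iff_eq_star_mul_self.mp hB.nonneg
  rw [star_eq_conjTranspose, ← Matrix.mul_assoc, Matrix.trace_mul_comm, ← Matrix.mul_assoc]
  exact (hA.mul_mul_conjTranspose_same y).trace_nonneg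

/-- With r a positive lower bound of the spectrum of D, the matrix D - r is positive semidefinite,
and the trace of a product of two such matrices is nonnegative. -/
lemma exists_mul_trace_le {D : Matrix n n ℝ} (hD : D.PosDef) :
    ∃ r : ℝ, 0 < r ∧ ∀ Ω : Matrix n n ℝ, Ω.PosSemidef → r * Ω.trace ≤ (D * Ω).trace := by
  obtain ⟨r, hr, h⟩ := exists_posSemidef_sub_smul_one hD
  refine ⟨r, hr, fun Ω hΩ ↦ ?_⟩
  have := trace_mul_nonneg h hΩ
  rw [sub_mul, smul_mul_assoc, one_mul, trace_sub, trace_smul, smul_eq_mul] at this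
  linarith

omit [DecidableEq n] in
lemma diag_le_trace {Ω : Matrix n n ℝ} (hΩ : Ω.PosSemidef) (i : n) : Ω i i ≤ Ω.trace :=
  Finset.single_le_sum (f := fun i ↦ Ω i i) (fun _ _ ↦ hΩ.diag_nonneg) (Finset.mem_univ i)

/-- Nonnegativity of the quadratic form at e_i ± e_j gives 2|Ω i j| ≤ Ω i i + Ω j j. -/
lemma abs_apply_le_trace {Ω : Matrix n n ℝ} (hΩ : Ω.PosSemidef) (i j : n) :
    |Ω i j| ≤ Ω.trace := by
  have h1 := hΩ.dotProduct_mulVec_nonneg (Pi.single i 1 + Pi.single j 1)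
  have h2 := hΩ.dotProduct_mulVec_nonneg (Pi.single i 1 - Pi.single j 1)
  have hs : Ω j i = Ω i j := by simpa using hΩ.isHermitian.apply i j
  simp [Matrix.mulVec_add, Matrix.mulVec_sub, hs] at h1 h2
  have := diag_le_trace hΩ i
  have := diag_le_trace hΩ j
  rw [abs_le]
  constructor <;> linarith

lemma det_le_trace_pow {Ω : Matrix n n ℝ} (hΩ : Ω.PosSemidef) :
    Ω.det ≤ (Fintype.card n).factorial * Ω.trace ^ Fintype.card n := by
  have := Matrix.det_le (A := Ω) (abv := AbsoluteValue.abs) (x := Ω.trace)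
    (fun i j ↦ abs_apply_le_trace hΩ i j)
  rw [nsmul_eq_mul] at this
  exact (le_abs_self _).trans this

end Matrices

/-! ### Exponential decay of the G-Wishart kernel -/

lemma rpow_le_mul_exp {s ε : ℝ} (hs : 0 ≤ s) (hε : 0 < ε) :
    ∃ C : ℝ, 0 ≤ C ∧ ∀ x : ℝ, 0 ≤ x → x ^ s ≤ C * Real.exp (ε * x) := by
  -- With δ = ε/(s+1), raise δx ≤ exp(δx) to the power s and use δs ≤ ε. The denominator s+1 keeps s
  -- = 0 admissible.
  have hδ : 0 < ε / (s + 1) := by positivity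
  refine ⟨((ε / (s + 1))⁻¹) ^ s, by positivity, fun x hx ↦ ?_⟩
  have h1 : x = (ε / (s + 1))⁻¹ * (ε / (s + 1) * x) := by field_simp
  conv_lhs => rw [h1]
  rw [Real.mul_rpow (by positivity) (by positivity)]
  gcongr
  calc (ε / (s + 1) * x) ^ s ≤ (Real.exp (ε / (s + 1) * x)) ^ s := by
        gcongr
        linarith [Real.add_one_le_exp (ε / (s + 1) * x)]
    _ = Real.exp (ε / (s + 1) * x * s) := (Real.exp_mul _ _).symm
    _ ≤ Real.exp (ε * x) := by
        refine Real.exp_le_exp.2 ?_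
        rw [div_mul_eq_mul_div, div_mul_eq_mul_div, div_le_iff₀ (by positivity)]
        nlinarith [mul_nonneg hε.le hx]

variable {p : ℕ}

/-- The G-Wishart kernel decays exponentially in the trace. -/
lemma exists_wishartKernel_le {b : ℝ} (hb : 2 < b) {D : Matrix (Fin p) (Fin p) ℝ}
    (hD : D.PosDef) : ∃ C r : ℝ, 0 ≤ C ∧ 0 < r ∧ ∀ Ω : Matrix (Fin p) (Fin p) ℝ, Ω.PosDef →
      wishartKernel b D Ω ≤ C * Real.exp (-(r * Ω.trace)) := by
  obtain ⟨r, hr, h⟩ := exists_mul_trace_le hD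
  have hb' : 0 < (b - 2) / 2 := by linarith
  -- The determinant grows at most like the p-th power of the trace. Its power is absorbed by half
  -- of the decay exp(-(r/2) tr Ω), which leaves the rate r/4.
  obtain ⟨C, hC, hCx⟩ := rpow_le_mul_exp (s := p * ((b - 2) / 2)) (ε := r / 4)
    (by positivity) (by positivity)
  refine ⟨(p.factorial : ℝ) ^ ((b - 2) / 2) * C, r / 4, by positivity, by positivity,
    fun Ω hΩ ↦ ?_⟩
  have htr : 0 ≤ Ω.trace := hΩ.posSemidef.trace_nonneg
  have hdet := det_le_trace_pow hΩ.posSemidef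
  rw [Fintype.card_fin] at hdet
  calc wishartKernel b D Ω
      ≤ (p.factorial * Ω.trace ^ p) ^ ((b - 2) / 2) * Real.exp (-(1 / 2) * (r * Ω.trace)) := by
        unfold wishartKernel
        have h1 := h Ω hΩ.posSemidef
        have h2 := hΩ.det_pos.le
        gcongr ?_ ^ ((b - 2) / 2) * Real.exp ?_
        linarith
    _ = (p.factorial : ℝ) ^ ((b - 2) / 2) * Ω.trace ^ (p * ((b - 2) / 2)) *
          Real.exp (-(1 / 2) * (r * Ω.trace)) := by
        rw [Real.mul_rpow (by positivity) (by positivity), ← Real.rpow_natCast, ← Real.rpow_mul htr]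
    _ ≤ (p.factorial : ℝ) ^ ((b - 2) / 2) * (C * Real.exp (r / 4 * Ω.trace)) *
          Real.exp (-(1 / 2) * (r * Ω.trace)) := by
        gcongr
        exact hCx _ htr
    _ = _ := by
        rw [mul_assoc, mul_assoc, ← Real.exp_add, mul_assoc]
        ring_nf

/-! ### Measurability -/

lemma measurable_matrix_apply (i j : Fin p) :
    Measurable fun Ω : Matrix (Fin p) (Fin p) ℝ ↦ Ω i j :=
  (measurable_pi_apply j).comp (measurable_pi_apply (X := fun _ ↦ Fin p → ℝ) i)

lemma measurable_matrix_of {α : Type*} [MeasurableSpace α] {f : α → Matrix (Fin p) (Fin p) ℝ}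
    (hf : ∀ i j, Measurable fun x ↦ f x i j) : Measurable f :=
  measurable_pi_lambda _ fun i ↦ measurable_pi_lambda _ fun j ↦ hf i j

lemma measurable_det : Measurable fun Ω : Matrix (Fin p) (Fin p) ℝ ↦ Ω.det := by
  simp only [Matrix.det_apply]
  refine Finset.measurable_sum _ fun σ _ ↦ ?_
  exact (Finset.measurable_prod _ fun i _ ↦ measurable_matrix_apply _ _).const_smul _

lemma measurable_normalDensity :
    Measurable fun x : (Fin p → ℝ) × Matrix (Fin p) (Fin p) ℝ × (Fin p → ℝ) ↦
      normalDensity x.1 x.2.1 x.2.2 := by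
  unfold normalDensity
  have h : ∀ i j, Measurable fun x : (Fin p → ℝ) × Matrix (Fin p) (Fin p) ℝ × (Fin p → ℝ) ↦
      x.2.1 i j := fun i j ↦ (measurable_matrix_apply i j).comp measurable_snd.fst
  have hd : Measurable fun x : (Fin p → ℝ) × Matrix (Fin p) (Fin p) ℝ × (Fin p → ℝ) ↦
      x.2.1.det := measurable_det.comp measurable_snd.fst
  simp only [dotProduct, mulVec, Pi.sub_apply]
  fun_prop

lemma measurable_wishartKernel (b : ℝ) :
    Measurable fun x : Matrix (Fin p) (Fin p) ℝ × Matrix (Fin p) (Fin p) ℝ ↦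
      wishartKernel b x.1 x.2 := by
  unfold wishartKernel
  have h : ∀ i j, Measurable fun x : Matrix (Fin p) (Fin p) ℝ × Matrix (Fin p) (Fin p) ℝ ↦
      x.1 i j := fun i j ↦ (measurable_matrix_apply i j).comp measurable_fst
  have h' : ∀ i j, Measurable fun x : Matrix (Fin p) (Fin p) ℝ × Matrix (Fin p) (Fin p) ℝ ↦
      x.2 i j := fun i j ↦ (measurable_matrix_apply i j).comp measurable_snd
  have hd : Measurable fun x : Matrix (Fin p) (Fin p) ℝ × Matrix (Fin p) (Fin p) ℝ ↦
      x.2.det := measurable_det.comp measurable_snd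
  simp only [trace, Matrix.diag, Matrix.mul_apply]
  fun_prop

/-- Positive semidefiniteness is a closed condition, and a positive semidefinite matrix is positive
definite exactly when its determinant is nonzero. -/
lemma measurableSet_posDef : MeasurableSet {Ω : Matrix (Fin p) (Fin p) ℝ | Ω.PosDef} := by
  have : {Ω : Matrix (Fin p) (Fin p) ℝ | Ω.PosDef} =
      {Ω : Matrix (Fin p) (Fin p) ℝ | Ω.PosSemidef} ∩ {Ω | Ω.det ≠ 0} := by
    ext Ω
    exact ⟨fun h ↦ ⟨h.posSemidef, h.det_pos.ne'⟩, fun h ↦ h.1.posDef_iff_det_ne_zero.2 h.2⟩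
  rw [this]
  refine MeasurableSet.inter ?_ (measurable_det (measurableSet_singleton 0).compl)
  have hc : IsClosed {Ω : Fin p → Fin p → ℝ | Matrix.PosSemidef (Matrix.of Ω)} := by
    simp only [posSemidef_iff_dotProduct_mulVec, Set.ofPred_and, Set.ofPred_forall]
    refine IsClosed.inter ?_ (isClosed_iInter fun x ↦ ?_)
    · simp only [Matrix.IsHermitian, ← Matrix.ext_iff, Set.ofPred_forall]
      refine isClosed_iInter fun i ↦ isClosed_iInter fun j ↦ ?_
      apply isClosed_eq <;> simp <;> fun_prop
    · apply isClosed_le continuous_const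
      simp only [dotProduct, mulVec, Matrix.of_apply]
      fun_prop
  exact hc.measurableSet

instance : MeasurableSingletonClass (SimpleGraph (Fin p)) where
  measurableSet_singleton G := by
    have h := SimpleGraph.measurable_edgeSet (V := Fin p)
      (measurableSet_singleton (G.edgeSet))
    convert h using 1
    ext G'
    simp

lemma measurable_symmOfFree (G : SimpleGraph (Fin p)) : Measurable (symmOfFree G) := by
  refine measurable_matrix_of fun i j ↦ ?_
  simp only [symmOfFree, Matrix.of_apply]
  split_ifs
  · exact measurable_pi_apply _
  · exact measurable_const

/-! ### Gaussian integrals -/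

lemma normalDensity_nonneg (μ : Fin p → ℝ) (Ω : Matrix (Fin p) (Fin p) ℝ) (z : Fin p → ℝ) :
    0 ≤ normalDensity μ Ω z := by
  have h : 0 ≤ Ω.det ^ (1 / 2 : ℝ) := by
    rw [← Real.sqrt_eq_rpow]
    exact Real.sqrt_nonneg _
  unfold normalDensity
  positivity

lemma lintegral_exp_neg_half_dotProduct :
    ∫⁻ z : Fin p → ℝ, ENNReal.ofReal (Real.exp (-(1 / 2) * (z ⬝ᵥ z))) =
      ENNReal.ofReal ((2 * Real.pi) ^ ((p : ℝ) / 2)) := by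
  have h : ∀ z : Fin p → ℝ, Real.exp (-(1 / 2) * (z ⬝ᵥ z)) =
      ∏ i, Real.exp (-(1 / 2) * z i ^ 2) := fun z ↦ by
    rw [← Real.exp_sum, ← Finset.mul_sum]
    simp only [dotProduct, sq]
  simp_rw [h]
  rw [← ofReal_integral_eq_lintegral_ofReal]
  · rw [integral_fintype_prod_volume_eq_prod (fun _ x ↦ Real.exp (-(1 / 2) * x ^ 2))]
    simp only [integral_gaussian, Finset.prod_const, Finset.card_univ, Fintype.card_fin]
    congr 1
    rw [Real.sqrt_eq_rpow, ← Real.rpow_natCast, ← Real.rpow_mul (by positivity)]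
    congr 1 <;> ring
  · exact Integrable.fintype_prod fun _ ↦ integrable_exp_neg_mul_sq (by norm_num)
  · exact .of_forall fun z ↦ Finset.prod_nonneg fun i _ ↦ (Real.exp_pos _).le

-- Write Ω = BᵀB and substitute z ↦ Bz: the Jacobian |det B| is the square root of det Ω, and the
-- standard Gaussian integral remains.
open scoped MatrixOrder in
lemma lintegral_normalDensity (μ : Fin p → ℝ) {Ω : Matrix (Fin p) (Fin p) ℝ} (hΩ : Ω.PosDef) :
    ∫⁻ z, ENNReal.ofReal (normalDensity μ Ω z) = 1 := by
  obtain ⟨B, rfl⟩ := CStarAlgebra.nonneg_iff_eq_star_mul_self.mp hΩ.posSemidef.nonneg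
  have hdet : (star B * B).det = B.det ^ 2 := by
    rw [det_mul, star_eq_conjTranspose, det_conjTranspose]
    simp [sq]
  have hB : B.det ≠ 0 := by
    have := hΩ.det_pos
    rw [hdet] at this
    exact fun h ↦ by simp [h] at this
  have hquad : ∀ z : Fin p → ℝ, z ⬝ᵥ ((star B * B) *ᵥ z) = (B *ᵥ z) ⬝ᵥ (B *ᵥ z) := fun z ↦ by
    rw [← mulVec_mulVec, dotProduct_mulVec, star_eq_conjTranspose, vecMul_conjTranspose]
    simp
  have hmeas : Measurable fun z : Fin p → ℝ ↦
      ENNReal.ofReal (Real.exp (-(1 / 2) * (z ⬝ᵥ z))) := by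
    simp only [dotProduct]
    fun_prop
  have hmap := lintegral_map (μ := volume) hmeas
    (LinearMap.continuous_of_finiteDimensional (Matrix.toLin' B)).measurable
  rw [Real.map_matrix_volume_pi_eq_smul_volume_pi hB, lintegral_smul_measure,
    lintegral_exp_neg_half_dotProduct] at hmap
  refine (lintegral_sub_right_eq_self
    (fun z ↦ ENNReal.ofReal ((star B * B).det ^ (1 / 2 : ℝ) / (2 * Real.pi) ^ ((p : ℝ) / 2) *
      Real.exp (-(1 / 2) * (z ⬝ᵥ ((star B * B) *ᵥ z))))) μ).trans ?_
  have hsq : (B.det ^ 2) ^ (1 / 2 : ℝ) = |B.det| := by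
    rw [← Real.sqrt_eq_rpow, Real.sqrt_sq_eq_abs]
  simp_rw [hquad, hdet, hsq]
  simp only [Matrix.toLin'_apply] at hmap
  have hc : 0 ≤ |B.det| / (2 * Real.pi) ^ ((p : ℝ) / 2) := by positivity
  simp_rw [ENNReal.ofReal_mul hc]
  rw [lintegral_const_mul _ (by
    have : Measurable fun z : Fin p → ℝ ↦ B *ᵥ z :=
      (LinearMap.continuous_of_finiteDimensional (Matrix.toLin' B)).measurable
    exact hmeas.comp this), ← hmap, smul_eq_mul, ← ENNReal.ofReal_mul (by positivity),
    ← ENNReal.ofReal_mul hc, ENNReal.ofReal_eq_one, abs_inv]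
  have := abs_pos.2 hB
  have : (0 : ℝ) < (2 * Real.pi) ^ ((p : ℝ) / 2) := by positivity
  field_simp

/-- The Gaussian kernel that is left when the mean is integrated out. -/
lemma normalDensity_mul_normalDensity {a : ℝ} (ha : 0 < a) {Ω : Matrix (Fin p) (Fin p) ℝ}
    (hΩ : Ω.PosDef) (μ₀ μ z : Fin p → ℝ) :
    normalDensity μ₀ (a • Ω) μ * normalDensity μ Ω z =
      Ω.det ^ (1 / 2 : ℝ) * Real.exp (-(1 / 2) * (a / (a + 1) *
        ((z - μ₀) ⬝ᵥ (Ω *ᵥ (z - μ₀))))) *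
        ((1 / (2 * Real.pi) ^ ((p : ℝ) / 2)) * (a / (a + 1)) ^ ((p : ℝ) / 2)) *
      normalDensity (μ₀ + (a + 1)⁻¹ • (z - μ₀)) ((a + 1) • Ω) μ := by
  have hd := hΩ.det_pos
  -- Completing the square in μ: the posterior mean is μ₀ + (z - μ₀)/(a+1) and the posterior
  -- precision is (a+1)Ω. Centring at μ₀ reduces this to an identity of quadratic forms.
  have hquad : a * ((μ - μ₀) ⬝ᵥ (Ω *ᵥ (μ - μ₀))) + (z - μ) ⬝ᵥ (Ω *ᵥ (z - μ)) =
      a / (a + 1) * ((z - μ₀) ⬝ᵥ (Ω *ᵥ (z - μ₀))) + (a + 1) *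
        ((μ - (μ₀ + (a + 1)⁻¹ • (z - μ₀))) ⬝ᵥ
          (Ω *ᵥ (μ - (μ₀ + (a + 1)⁻¹ • (z - μ₀))))) := by
    obtain ⟨x, rfl⟩ : ∃ x, z = μ₀ + x := ⟨z - μ₀, by simp⟩
    obtain ⟨y, rfl⟩ : ∃ y, μ = μ₀ + y := ⟨μ - μ₀, by simp⟩
    simp only [add_sub_add_left_eq_sub, add_sub_cancel_left, mulVec_sub, mulVec_smul,
      dotProduct_sub, sub_dotProduct, dotProduct_smul, smul_dotProduct, smul_eq_mul]
    field_simp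
    ring
  have hpow : ∀ c : ℝ, 0 < c →
      (c ^ p * Ω.det) ^ (1 / 2 : ℝ) = c ^ ((p : ℝ) / 2) * Ω.det ^ (1 / 2 : ℝ) := fun c hc ↦ by
    rw [Real.mul_rpow (by positivity) hd.le, ← Real.rpow_natCast, ← Real.rpow_mul hc.le]
    congr 2
    ring
  unfold normalDensity
  simp only [det_smul, Fintype.card_fin, smul_mulVec, dotProduct_smul, smul_eq_mul]
  rw [hpow a ha, hpow (a + 1) (by positivity), Real.div_rpow ha.le (by positivity)]
  have e : Real.exp (-(1 / 2) * (a * ((μ - μ₀) ⬝ᵥ (Ω *ᵥ (μ - μ₀))))) *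
        Real.exp (-(1 / 2) * ((z - μ) ⬝ᵥ (Ω *ᵥ (z - μ)))) =
      Real.exp (-(1 / 2) * (a / (a + 1) * ((z - μ₀) ⬝ᵥ (Ω *ᵥ (z - μ₀))))) *
        Real.exp (-(1 / 2) * ((a + 1) * ((μ - (μ₀ + (a + 1)⁻¹ • (z - μ₀))) ⬝ᵥ
          (Ω *ᵥ (μ - (μ₀ + (a + 1)⁻¹ • (z - μ₀))))))) := by
    rw [← Real.exp_add, ← Real.exp_add, ← mul_add, ← mul_add, hquad]
  have h1 : (0 : ℝ) < (a + 1) ^ ((p : ℝ) / 2) := by positivity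
  have h2 : (0 : ℝ) < (2 * Real.pi) ^ ((p : ℝ) / 2) := by positivity
  generalize Real.exp (-(1 / 2) * (a * _)) = e1 at *
  generalize Real.exp (-(1 / 2) * ((z - μ) ⬝ᵥ _)) = e2 at *
  generalize Real.exp (-(1 / 2) * (a / (a + 1) * _)) = e3 at *
  generalize Real.exp (-(1 / 2) * ((a + 1) * _)) = e4 at *
  field_simp
  linear_combination e

lemma matB_sub_matA (H : Hyper p) (ha : 0 < H.a) (z : Fin p → ℝ) :
    matB H z - matA H z = (H.a / (H.a + 1)) • vecMulVec (z - H.μ₀) (z - H.μ₀) := by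
  ext i j
  simp only [matA, matB, Matrix.sub_apply, Matrix.add_apply, Matrix.smul_apply, vecMulVec_apply,
    Pi.add_apply, Pi.sub_apply, Pi.smul_apply, smul_eq_mul]
  field_simp
  ring

lemma trace_add_matB_sub_matA (H : Hyper p) (ha : 0 < H.a) (z : Fin p → ℝ)
    (Ω : Matrix (Fin p) (Fin p) ℝ) :
    ((H.D + matB H z - matA H z) * Ω).trace =
      (H.D * Ω).trace + H.a / (H.a + 1) * ((z - H.μ₀) ⬝ᵥ (Ω *ᵥ (z - H.μ₀))) := by
  rw [add_sub_assoc, matB_sub_matA H ha, add_mul, trace_add, smul_mul_assoc, trace_smul,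
    vecMulVec_mul, trace_vecMulVec, smul_eq_mul, dotProduct_mulVec, dotProduct_comm]

lemma posDef_add_matB_sub_matA {H : Hyper p} (hH : H.Valid) (z : Fin p → ℝ) :
    (H.D + matB H z - matA H z).PosDef := by
  rw [add_sub_assoc, matB_sub_matA H hH.a_pos]
  refine hH.D_posDef.add_posSemidef (PosSemidef.smul ?_ ?_)
  · simpa using posSemidef_vecMulVec_self_star (z - H.μ₀)
  · have := hH.a_pos
    positivity

/-! ### The G-Wishart law -/

instance (G : SimpleGraph (Fin p)) : SFinite (coneMeasure G) := by
  unfold coneMeasure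
  infer_instance

lemma ae_posDef_coneMeasure (G : SimpleGraph (Fin p)) : ∀ᵐ Ω ∂coneMeasure G, Ω.PosDef :=
  ae_restrict_mem measurableSet_posDef

lemma wishartKernel_pos (b : ℝ) (D : Matrix (Fin p) (Fin p) ℝ) {Ω : Matrix (Fin p) (Fin p) ℝ}
    (hΩ : Ω.PosDef) : 0 < wishartKernel b D Ω := by
  have := hΩ.det_pos
  unfold wishartKernel
  positivity

lemma abs_le_trace_symmOfFree (G : SimpleGraph (Fin p)) {x : FreeEntry G → ℝ}
    (hx : (symmOfFree G x).PosDef) (e : FreeEntry G) : |x e| ≤ (symmOfFree G x).trace := by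
  obtain ⟨⟨i, j⟩, h⟩ := e
  have := abs_apply_le_trace hx.posSemidef i j
  simp only [symmOfFree, Matrix.of_apply] at this ⊢
  rwa [dif_pos h] at this

lemma measurable_wishartKernel_right (b : ℝ) (D : Matrix (Fin p) (Fin p) ℝ) :
    Measurable fun Ω ↦ wishartKernel b D Ω :=
  (measurable_wishartKernel b).comp (measurable_const.prodMk measurable_id)

lemma integrable_exp_neg_mul_abs {c : ℝ} (hc : 0 < c) :
    Integrable fun x : ℝ ↦ Real.exp (-c * |x|) := by
  rw [← integrableOn_univ, ← Set.Iic_union_Ioi (a := (0 : ℝ)), integrableOn_union]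
  constructor
  · refine (integrableOn_exp_mul_Iic hc 0).congr_fun (fun x hx ↦ ?_) measurableSet_Iic
    simp [abs_of_nonpos (Set.mem_Iic.1 hx)]
  · refine (integrableOn_exp_mul_Ioi (neg_neg_of_pos hc) 0).congr_fun (fun x hx ↦ ?_)
      measurableSet_Ioi
    simp [abs_of_pos (Set.mem_Ioi.1 hx)]

/-- On the cone every free entry is bounded by the trace, so exponential decay in the trace is
dominated by a product of one-dimensional functions exp(-c|x_e|). -/
lemma integrable_wishartKernel (G : SimpleGraph (Fin p)) {b : ℝ} (hb : 2 < b)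
    {D : Matrix (Fin p) (Fin p) ℝ} (hD : D.PosDef) :
    Integrable (wishartKernel b D) (coneMeasure G) := by
  obtain ⟨C, r, hC, hr, h⟩ := exists_wishartKernel_le hb hD
  have hm := (measurable_wishartKernel_right b D)
  have hS := (measurable_symmOfFree G) measurableSet_posDef
  unfold coneMeasure
  rw [Measure.restrict_map (measurable_symmOfFree G) measurableSet_posDef,
    integrable_map_measure hm.aestronglyMeasurable (measurable_symmOfFree G).aemeasurable]
  -- The number of free entries bounds ∑|x e| / tr; adding 1 keeps the divisor positive when there
  -- are none.
  set m : ℝ := Fintype.card (FreeEntry G) + 1 with hm_def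
  have hmpos : 0 < m := by positivity
  have hint : Integrable (fun x : FreeEntry G → ℝ ↦ C * ∏ e, Real.exp (-(r / m) * |x e|)) := by
    refine Integrable.const_mul (Integrable.fintype_prod (μ := fun _ ↦ volume)
      (f := fun _ x ↦ Real.exp (-(r / m) * |x|)) fun _ ↦ ?_) C
    exact integrable_exp_neg_mul_abs (by positivity)
  refine hint.integrableOn.mono' (hm.comp (measurable_symmOfFree G)).aestronglyMeasurable ?_
  filter_upwards [ae_restrict_mem hS] with x hx
  have hx' : (symmOfFree G x).PosDef := hx
  rw [Function.comp_apply, Real.norm_of_nonneg (wishartKernel_pos b D hx').le]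
  refine (h _ hx').trans ?_
  rw [← Real.exp_sum]
  gcongr
  rw [← Finset.mul_sum, neg_mul, neg_le_neg_iff, div_mul_eq_mul_div, mul_div_assoc]
  gcongr
  rw [div_le_iff₀ hmpos]
  have htr := hx'.posSemidef.trace_nonneg
  calc ∑ e, |x e| ≤ ∑ _e : FreeEntry G, (symmOfFree G x).trace :=
        Finset.sum_le_sum fun e _ ↦ abs_le_trace_symmOfFree G hx' e
    _ = (symmOfFree G x).trace * Fintype.card (FreeEntry G) := by simp [mul_comm]
    _ ≤ _ := by gcongr; simp [hm_def]

/-- The identity matrix is interior to the cone in the free coordinates: changing each entry by at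
most ε = 1/(p+1) changes the form at v by at most εp|v|² < |v|², so a whole ball is positive
definite. Positivity of I_G rests on this. -/
lemma coneMeasure_ne_zero (G : SimpleGraph (Fin p)) : coneMeasure G ≠ 0 := by
  have hp : (0 : ℝ) < p + 1 := by positivity
  set ε : ℝ := (p + 1 : ℝ)⁻¹ with hε
  have hε0 : 0 < ε := by positivity
  have hεp : ε * p < 1 := by
    rw [hε, inv_mul_lt_iff₀ hp]
    linarith
  classical
  let x₀ : FreeEntry G → ℝ := fun e ↦ if e.1.IsDiag then 1 else 0
  have hball : Metric.ball x₀ ε ⊆ symmOfFree G ⁻¹' {Ω | Ω.PosDef} := by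
    intro x hx
    have hx' : ∀ e, |x e - x₀ e| ≤ ε := fun e ↦
      (norm_le_pi_norm (x - x₀) e).trans (mem_ball_iff_norm.1 hx).le
    have hentry : ∀ i j, |symmOfFree G x i j - (1 : Matrix (Fin p) (Fin p) ℝ) i j| ≤ ε := by
      intro i j
      simp only [symmOfFree, Matrix.of_apply]
      split_ifs with h
      · have := hx' ⟨s(i, j), h⟩
        simpa [x₀, Matrix.one_apply] using this
      · have hij : i ≠ j := fun hij ↦ h (Or.inl (by simpa using hij))
        simp [Matrix.one_apply_ne hij, hε0.le]
    refine Set.mem_preimage.2 (PosDef.of_dotProduct_mulVec_pos ?_ fun {v} hv ↦ ?_)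
    · ext i j
      simp only [conjTranspose_apply, symmOfFree, Matrix.of_apply, Sym2.eq_swap (a := j),
        star_trivial]
    · have hvpos : 0 < v ⬝ᵥ v := by
        have := dotProduct_star_self_pos_iff.2 hv
        simpa using this
      have hsplit : v ⬝ᵥ (symmOfFree G x *ᵥ v) = v ⬝ᵥ v +
          v ⬝ᵥ ((symmOfFree G x - 1) *ᵥ v) := by
        rw [sub_mulVec, dotProduct_sub, one_mulVec]
        ring
      have hle : -(ε * p * (v ⬝ᵥ v)) ≤ v ⬝ᵥ ((symmOfFree G x - 1) *ᵥ v) := by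
        have hterm : ∀ i j, -(ε * ((v i ^ 2 + v j ^ 2) / 2)) ≤
            v i * ((symmOfFree G x - 1) i j * v j) := fun i j ↦ by
          have h1 := hentry i j
          rw [← Matrix.sub_apply] at h1
          generalize (symmOfFree G x - 1) i j = c at *
          have h2 : |v i * (c * v j)| ≤ ε * ((v i ^ 2 + v j ^ 2) / 2) := by
            rw [abs_mul, abs_mul]
            calc |v i| * (|c| * |v j|) = |c| * (|v i| * |v j|) := by ring
              _ ≤ ε * ((v i ^ 2 + v j ^ 2) / 2) := by
                gcongr
                rw [← sq_abs (v i), ← sq_abs (v j)]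
                nlinarith [sq_nonneg (|v i| - |v j|)]
          exact (abs_le.1 h2).1
        calc -(ε * p * (v ⬝ᵥ v)) = ∑ i, ∑ j, -(ε * ((v i ^ 2 + v j ^ 2) / 2)) := by
              simp only [Finset.sum_neg_distrib, ← Finset.mul_sum, ← Finset.sum_div,
                Finset.sum_add_distrib, Finset.sum_const, Finset.card_univ, Fintype.card_fin,
                nsmul_eq_mul, dotProduct, sq]
              rw [show ∑ i, v i * ((p : ℝ) * v i) = p * ∑ i, v i * v i by
                rw [Finset.mul_sum]; exact Finset.sum_congr rfl fun i _ ↦ by ring]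
              ring
          _ ≤ ∑ i, ∑ j, v i * ((symmOfFree G x - 1) i j * v j) :=
              Finset.sum_le_sum fun i _ ↦ Finset.sum_le_sum fun j _ ↦ hterm i j
          _ = _ := by simp only [dotProduct, mulVec, Finset.mul_sum]
      rw [star_trivial, hsplit]
      nlinarith
  intro h0
  have h1 : coneMeasure G {Ω | Ω.PosDef} = 0 := by simp [h0]
  rw [coneMeasure, Measure.restrict_apply_self,
    Measure.map_apply (measurable_symmOfFree G) measurableSet_posDef] at h1
  exact (Metric.measure_ball_pos volume x₀ hε0).ne' (measure_mono_null hball h1)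

lemma wishartConst_pos (G : SimpleGraph (Fin p)) {b : ℝ} (hb : 2 < b)
    {D : Matrix (Fin p) (Fin p) ℝ} (hD : D.PosDef) : 0 < wishartConst G b D := by
  have hpos : ∀ᵐ Ω ∂coneMeasure G, 0 < wishartKernel b D Ω :=
    (ae_posDef_coneMeasure G).mono fun Ω hΩ ↦ wishartKernel_pos b D hΩ
  refine (integral_pos_iff_support_of_nonneg_ae (hpos.mono fun _ h ↦ h.le)
    (integrable_wishartKernel G hb hD)).2 ?_
  rw [pos_iff_ne_zero]
  intro h0
  refine coneMeasure_ne_zero G (ae_eq_bot.1 (Filter.eventually_false_iff_eq_bot.1 ?_))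
  filter_upwards [hpos, measure_eq_zero_iff_ae_notMem.1 h0] with Ω h1 h2
  exact h2 h1.ne'

lemma lintegral_wishartKernel (G : SimpleGraph (Fin p)) {b : ℝ} (hb : 2 < b)
    {D : Matrix (Fin p) (Fin p) ℝ} (hD : D.PosDef) :
    ∫⁻ Ω, ENNReal.ofReal (wishartKernel b D Ω) ∂coneMeasure G =
      ENNReal.ofReal (wishartConst G b D) :=
  (ofReal_integral_eq_lintegral_ofReal (integrable_wishartKernel G hb hD)
    ((ae_posDef_coneMeasure G).mono fun _ hΩ ↦ (wishartKernel_pos b D hΩ).le)).symm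

lemma lintegral_gWishart (G : SimpleGraph (Fin p)) {b : ℝ} (hb : 2 < b)
    {D : Matrix (Fin p) (Fin p) ℝ} (hD : D.PosDef) {F : Matrix (Fin p) (Fin p) ℝ → ℝ≥0∞}
    (hF : Measurable F) :
    ∫⁻ Ω, F Ω ∂gWishart G b D = ENNReal.ofReal (wishartConst G b D)⁻¹ *
      ∫⁻ Ω, ENNReal.ofReal (wishartKernel b D Ω) * F Ω ∂coneMeasure G := by
  have hk := measurable_wishartKernel_right b D
  have hc : 0 ≤ (wishartConst G b D)⁻¹ := (inv_pos.2 (wishartConst_pos G hb hD)).le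
  rw [gWishart, lintegral_withDensity_eq_lintegral_mul _ (hk.const_mul _).ennreal_ofReal hF,
    ← lintegral_const_mul' _ _ ENNReal.ofReal_ne_top]
  simp only [Pi.mul_apply, ENNReal.ofReal_mul hc, mul_assoc]

instance (G : SimpleGraph (Fin p)) (b : ℝ) (D : Matrix (Fin p) (Fin p) ℝ) :
    SFinite (gWishart G b D) := by
  unfold gWishart
  infer_instance

/-! ### The prior of the parameters of one cluster -/

/-- These are the point masses of the binomial random graph, a probability measure. -/
lemma sum_graphPrior {q : ℝ} (h0 : 0 ≤ q) (h1 : q ≤ 1) :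
    ∑ G : SimpleGraph (Fin p), ENNReal.ofReal (graphPrior q G) = 1 := by
  let I : unitInterval := ⟨q, h0, h1⟩
  have h : ∀ G : SimpleGraph (Fin p), ENNReal.ofReal (graphPrior q G) =
      SimpleGraph.binomialRandom (Fin p) I {G} := fun G ↦ by
    have h1' : 0 ≤ 1 - q := by linarith
    rw [SimpleGraph.binomialRandom_singleton, graphPrior, ENNReal.ofReal_mul (by positivity),
      ENNReal.ofReal_pow h0, ENNReal.ofReal_pow h1', Nat.card_fin]
    congr 2
    · rw [ENNReal.ofReal, Real.toNNReal_of_nonneg h0]; rfl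
    · rw [ENNReal.ofReal, Real.toNNReal_of_nonneg h1']; rfl
  simp_rw [h]
  rw [sum_measure_singleton, Finset.coe_univ, measure_univ]

lemma measurable_normalDensity_mean (μ₀ : Fin p → ℝ) (a : ℝ) :
    Measurable fun x : Matrix (Fin p) (Fin p) ℝ × (Fin p → ℝ) ↦
      normalDensity μ₀ (a • x.1) x.2 := by
  refine measurable_normalDensity.comp (f := fun x : Matrix (Fin p) (Fin p) ℝ × (Fin p → ℝ) ↦
    (μ₀, a • x.1, x.2)) (measurable_const.prodMk (Measurable.prodMk ?_ measurable_snd))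
  refine measurable_matrix_of fun i j ↦ ?_
  exact ((measurable_matrix_apply i j).comp measurable_fst).const_mul a

lemma lintegral_clusterPrior {H : Hyper p} (hH : H.Valid) {F : ClusterParam p → ℝ≥0∞}
    (hF : Measurable F) :
    ∫⁻ φ, F φ ∂clusterPrior H = ∑ G : SimpleGraph (Fin p), ENNReal.ofReal (graphPrior H.q G) *
      (ENNReal.ofReal (wishartConst G H.b H.D)⁻¹ *
        ∫⁻ Ω, ENNReal.ofReal (wishartKernel H.b H.D Ω) *
          (∫⁻ μ, ENNReal.ofReal (normalDensity H.μ₀ (H.a • Ω) μ) * F (G, Ω, μ))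
        ∂coneMeasure G) := by
  rw [clusterPrior, lintegral_finsetSum_measure]
  refine Finset.sum_congr rfl fun G _ ↦ ?_
  have hFG : Measurable fun x : Matrix (Fin p) (Fin p) ℝ × (Fin p → ℝ) ↦ F (G, x) :=
    hF.comp measurable_prodMk_left
  have hn := (measurable_normalDensity_mean H.μ₀ H.a).ennreal_ofReal
  rw [lintegral_smul_measure, lintegral_map hF measurable_prodMk_left,
    lintegral_withDensity_eq_lintegral_mul _ hn hFG,
    lintegral_prod _ (hn.mul hFG).aemeasurable,
    lintegral_gWishart G hH.two_lt_b hH.D_posDef (hn.mul hFG).lintegral_prod_right', smul_eq_mul]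
  rfl

lemma isProbabilityMeasure_clusterPrior {H : Hyper p} (hH : H.Valid) :
    IsProbabilityMeasure (clusterPrior H) := by
  constructor
  rw [← lintegral_one, lintegral_clusterPrior hH measurable_const]
  refine Eq.trans ?_ (sum_graphPrior (p := p) hH.q_pos.le hH.q_lt_one.le)
  refine Finset.sum_congr rfl fun G _ ↦ ?_
  have hc := wishartConst_pos G hH.two_lt_b hH.D_posDef
  have : ∫⁻ Ω, ENNReal.ofReal (wishartKernel H.b H.D Ω) *
      (∫⁻ μ, ENNReal.ofReal (normalDensity H.μ₀ (H.a • Ω) μ) * 1) ∂coneMeasure G =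
      ∫⁻ Ω, ENNReal.ofReal (wishartKernel H.b H.D Ω) ∂coneMeasure G := by
    refine lintegral_congr_ae ((ae_posDef_coneMeasure G).mono fun Ω hΩ ↦ ?_)
    simp only [mul_one]
    rw [lintegral_normalDensity _ (hΩ.smul hH.a_pos), mul_one]
  rw [this, lintegral_wishartKernel G hH.two_lt_b hH.D_posDef,
    ← ENNReal.ofReal_mul (inv_pos.2 hc).le, inv_mul_cancel₀ hc.ne', ENNReal.ofReal_one, mul_one]

lemma graphPrior_pos {q : ℝ} (h0 : 0 < q) (h1 : q < 1) (G : SimpleGraph (Fin p)) :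
    0 < graphPrior q G := by
  have : 0 < 1 - q := by linarith
  unfold graphPrior
  positivity

lemma mNew_nonneg {H : Hyper p} (hH : H.Valid) (z : Fin p → ℝ) : 0 ≤ mNew H z := by
  have ha := hH.a_pos
  unfold mNew
  refine mul_nonneg (mul_nonneg (Finset.sum_nonneg fun G _ ↦ ?_) (by positivity)) (by positivity)
  have h1 := graphPrior_pos hH.q_pos hH.q_lt_one G
  have h2 := wishartConst_pos G hH.two_lt_b hH.D_posDef
  have h3 := wishartConst_pos G (b := H.b + 1) (by linarith [hH.two_lt_b])
    (posDef_add_matB_sub_matA hH z)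
  positivity

/-- The marginal likelihood of one individual in a new cluster. -/
lemma lintegral_normalDensity_clusterPrior {H : Hyper p} (hH : H.Valid) (z : Fin p → ℝ) :
    ∫⁻ φ, ENNReal.ofReal (normalDensity φ.2.2 φ.2.1 z) ∂clusterPrior H =
      ENNReal.ofReal (mNew H z) := by
  have ha := hH.a_pos
  have hb : 2 < H.b + 1 := by linarith [hH.two_lt_b]
  set c : ℝ := (1 / (2 * Real.pi) ^ ((p : ℝ) / 2)) * (H.a / (H.a + 1)) ^ ((p : ℝ) / 2) with hc
  have hc0 : 0 ≤ c := by positivity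
  have hmeas : Measurable fun φ : ClusterParam p ↦
      ENNReal.ofReal (normalDensity φ.2.2 φ.2.1 z) :=
    (measurable_normalDensity.comp (measurable_snd.snd.prodMk
      (measurable_snd.fst.prodMk measurable_const))).ennreal_ofReal
  rw [lintegral_clusterPrior hH hmeas, mNew, mul_assoc, ← hc, Finset.sum_mul,
    ENNReal.ofReal_sum_of_nonneg]
  swap
  · intro G _
    have h1 := graphPrior_pos hH.q_pos hH.q_lt_one G
    have h2 := wishartConst_pos G hH.two_lt_b hH.D_posDef
    have h3 := wishartConst_pos G hb (posDef_add_matB_sub_matA hH z)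
    positivity
  refine Finset.sum_congr rfl fun G _ ↦ ?_
  have h1 := graphPrior_pos hH.q_pos hH.q_lt_one G
  have h2 := wishartConst_pos G hH.two_lt_b hH.D_posDef
  have h3 := wishartConst_pos G hb (posDef_add_matB_sub_matA hH z)
  have hint : ∫⁻ Ω, ENNReal.ofReal (wishartKernel H.b H.D Ω) *
      (∫⁻ μ, ENNReal.ofReal (normalDensity H.μ₀ (H.a • Ω) μ) *
        ENNReal.ofReal (normalDensity μ Ω z)) ∂coneMeasure G =
      ∫⁻ Ω, ENNReal.ofReal (wishartKernel (H.b + 1) (H.D + matB H z - matA H z) Ω) *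
        ENNReal.ofReal c ∂coneMeasure G := by
    refine lintegral_congr_ae ((ae_posDef_coneMeasure G).mono fun Ω hΩ ↦ ?_)
    have hd := hΩ.det_pos
    simp_rw [← ENNReal.ofReal_mul (normalDensity_nonneg _ _ _),
      normalDensity_mul_normalDensity ha hΩ, ← hc]
    have hk : 0 ≤ Ω.det ^ (1 / 2 : ℝ) * Real.exp (-(1 / 2) * (H.a / (H.a + 1) *
        ((z - H.μ₀) ⬝ᵥ (Ω *ᵥ (z - H.μ₀))))) * c := by positivity
    simp_rw [ENNReal.ofReal_mul hk]
    rw [lintegral_const_mul' _ _ ENNReal.ofReal_ne_top,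
      lintegral_normalDensity _ (hΩ.smul (by positivity)), mul_one,
      ← ENNReal.ofReal_mul (wishartKernel_pos _ _ hΩ).le,
      ← ENNReal.ofReal_mul (wishartKernel_pos _ _ hΩ).le, ← mul_assoc]
    congr 2
    -- The factor det Ω ^ (1/2) left over from the Gaussians raises b to b+1, and the quadratic form
    -- in z - μ₀ is tr((B-A)Ω).
    unfold wishartKernel
    rw [trace_add_matB_sub_matA H ha, mul_add, Real.exp_add,
      show (H.b + 1 - 2) / 2 = (H.b - 2) / 2 + 1 / 2 by ring, Real.rpow_add hd]
    ring
  rw [hint, lintegral_mul_const _ (measurable_wishartKernel_right _ _).ennreal_ofReal,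
    lintegral_wishartKernel G hb (posDef_add_matB_sub_matA hH z),
    ← ENNReal.ofReal_mul h3.le, ← ENNReal.ofReal_mul (inv_pos.2 h2).le,
    ← ENNReal.ofReal_mul h1.le]
  congr 1
  field_simp

/-- Measurability is read off the identity with a parametric integral, which avoids studying
`wishartConst` as a function of its matrix argument. -/
lemma measurable_mNew {H : Hyper p} (hH : H.Valid) : Measurable (mNew H) := by
  have := isProbabilityMeasure_clusterPrior hH
  have h : Measurable fun z ↦
      ∫⁻ φ, ENNReal.ofReal (normalDensity φ.2.2 φ.2.1 z) ∂clusterPrior H := by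
    refine Measurable.lintegral_prod_right' (f := fun x : (Fin p → ℝ) × ClusterParam p ↦
      ENNReal.ofReal (normalDensity x.2.2.2 x.2.2.1 x.1)) ?_
    exact (measurable_normalDensity.comp (measurable_snd.snd.snd.prodMk
      (measurable_snd.snd.fst.prodMk measurable_fst))).ennreal_ofReal
  simp_rw [lintegral_normalDensity_clusterPrior hH] at h
  convert h.ennreal_toReal using 2 with z
  rw [ENNReal.toReal_ofReal (mNew_nonneg hH z)]

/-! ### Rising factorials and label configurations -/

/-- The rising factorial `x (x + 1) ⋯ (x + n - 1)`. -/
def rising (x : ℝ) (n : ℕ) : ℝ := ∏ m ∈ Finset.range n, (x + m)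

lemma rising_zero (x : ℝ) : rising x 0 = 1 := by simp [rising]

lemma rising_succ (x : ℝ) (n : ℕ) : rising x (n + 1) = rising x n * (x + n) :=
  Finset.prod_range_succ _ _

lemma rising_pos {x : ℝ} (hx : 0 < x) (n : ℕ) : 0 < rising x n :=
  Finset.prod_pos fun _ _ ↦ by positivity

lemma Gamma_add_natCast {x : ℝ} (hx : 0 < x) (n : ℕ) :
    Real.Gamma (x + n) = rising x n * Real.Gamma x := by
  induction n with
  | zero => simp [rising_zero]
  | succ n ih =>
    rw [Nat.cast_succ, ← add_assoc, Real.Gamma_add_one (by positivity), ih, rising_succ]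
    ring

section Labels

variable {ι κ : Type*} [Fintype ι] [Fintype κ] [DecidableEq κ]

/-- The product over the labels `l` of the rising factorials of `γ` of order `#{i | c i = l}`. -/
def labelWeight (γ : ℝ) (c : ι → κ) : ℝ :=
  ∏ l, rising γ (Finset.univ.filter fun i ↦ c i = l).card

lemma labelWeight_pos {γ : ℝ} (hγ : 0 < γ) (c : ι → κ) : 0 < labelWeight γ c :=
  Finset.prod_pos fun _ _ ↦ rising_pos hγ _

variable [DecidableEq ι]

omit [Fintype κ] in
lemma card_filter_eq_add (c : ι → κ) (i : ι) (l : κ) :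
    (Finset.univ.filter fun j ↦ c j = l).card =
      (Finset.univ.filter fun j : {j // j ≠ i} ↦ c j = l).card + if c i = l then 1 else 0 := by
  have h : (Finset.univ.filter fun j ↦ c j = l) =
      (Finset.univ.filter fun j : {j // j ≠ i} ↦ c j = l).map (Function.Embedding.subtype _) ∪
        if c i = l then {i} else ∅ := by
    ext j
    by_cases hj : j = i
    · subst hj
      split_ifs with hc <;> simp [hc]
    · split_ifs with hc <;> simp [hj]
  rw [h, Finset.card_union_of_disjoint, Finset.card_map]
  · split_ifs <;> simp
  · split_ifs <;> simp

/-- Removing `i` shortens only the rising factorial of its own label, by its last factor. -/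
lemma labelWeight_eq_mul (γ : ℝ) (c : ι → κ) (i : ι) :
    labelWeight γ c = labelWeight γ (fun j : {j // j ≠ i} ↦ c j) *
      (γ + (Finset.univ.filter fun j : {j // j ≠ i} ↦ c j = c i).card) := by
  have h : ∀ l, rising γ (Finset.univ.filter fun j ↦ c j = l).card =
      rising γ (Finset.univ.filter fun j : {j // j ≠ i} ↦ c j = l).card * if c i = l then
        (γ + (Finset.univ.filter fun j : {j // j ≠ i} ↦ c j = c i).card) else 1 := fun l ↦ by
    rw [card_filter_eq_add c i l]
    split_ifs with hl
    · subst hl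
      rw [rising_succ]
    · simp
  simp_rw [labelWeight, h]
  rw [Finset.prod_mul_distrib, Finset.prod_ite_eq]
  simp

/-- Induction on the number of individuals: summing the last factor over the label of the added one
gives ∑_l (γ + n_l) = γ·#κ + n, the next factor of the rising factorial. -/
lemma sum_labelWeight (γ : ℝ) :
    ∑ c : ι → κ, labelWeight γ c = rising (γ * Fintype.card κ) (Fintype.card ι) := by
  induction hn : Fintype.card ι generalizing ι with
  | zero =>
    have := Fintype.card_eq_zero_iff.1 hn
    simp [labelWeight, rising_zero]
  | succ n ih =>
    obtain ⟨i⟩ : Nonempty ι := Fintype.card_pos_iff.1 (by omega)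
    have hcard : Fintype.card {j // j ≠ i} = n := by
      rw [Fintype.card_subtype_compl, Fintype.card_subtype_eq, hn, Nat.add_sub_cancel]
    rw [← (Equiv.funSplitAt i κ).symm.sum_comp, Fintype.sum_prod_type_right, rising_succ, ← ih hcard,
      Finset.sum_mul]
    refine Finset.sum_congr rfl fun c _ ↦ ?_
    have h : ∀ l, labelWeight γ ((Equiv.funSplitAt i κ).symm (l, c)) =
        labelWeight γ c * (γ + (Finset.univ.filter fun j ↦ c j = l).card) := fun l ↦ by
      rw [labelWeight_eq_mul γ _ i]
      have : ∀ j : {j // j ≠ i}, (Equiv.funSplitAt i κ).symm (l, c) j = c j := fun j ↦ by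
        simp [Equiv.funSplitAt, Equiv.piSplitAt, j.2]
      simp only [this]
      simp [Equiv.funSplitAt, Equiv.piSplitAt]
    simp_rw [h]
    rw [← Finset.mul_sum, Finset.sum_add_distrib, ← Nat.cast_sum,
      Finset.sum_card_fiberwise_eq_card_filter]
    simp [hcard, mul_comm]

end Labels

/-! ### Moments of the symmetric Dirichlet law -/

/-- Multiplying the Gamma(γ, 1) density by xⁿ exp(-ux) gives a multiple of the Gamma(γ+n, 1+u)
density, which has total mass 1. -/
lemma lintegral_pow_mul_exp_gammaMeasure {γ u : ℝ} (hγ : 0 < γ) (hu : 0 ≤ u) (n : ℕ) :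
    ∫⁻ x, ENNReal.ofReal (x ^ n * Real.exp (-(u * x))) ∂gammaMeasure γ 1 =
      ENNReal.ofReal (rising γ n * ((1 + u)⁻¹ ^ n * (1 + u)⁻¹ ^ γ)) := by
  have hc : 0 ≤ rising γ n * ((1 + u)⁻¹ ^ n * (1 + u)⁻¹ ^ γ) := by
    have := rising_pos hγ n
    positivity
  have hmeas : Measurable fun x : ℝ ↦ ENNReal.ofReal (x ^ n * Real.exp (-(u * x))) := by fun_prop
  have hpdf : ∀ a r : ℝ, Measurable (gammaPDF a r) := fun a r ↦
    (measurable_gammaPDFReal a r).ennreal_ofReal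
  rw [gammaMeasure, lintegral_withDensity_eq_lintegral_mul _ (hpdf _ _) hmeas]
  have key : ∀ᵐ x : ℝ, (gammaPDF γ 1 * fun x ↦ ENNReal.ofReal (x ^ n * Real.exp (-(u * x)))) x =
      ENNReal.ofReal (rising γ n * ((1 + u)⁻¹ ^ n * (1 + u)⁻¹ ^ γ)) *
        gammaPDF (γ + n) (1 + u) x := by
    -- Splitting the real power of x requires x > 0, so the null point 0 is discarded.
    filter_upwards [Measure.ae_ne volume 0] with x hx
    rw [Pi.mul_apply, gammaPDF, gammaPDF]
    rcases lt_or_gt_of_ne hx with hx | hx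
    · simp [gammaPDFReal, not_le.2 hx]
    · simp only [gammaPDFReal, hx.le, if_true]
      have hG := Real.Gamma_pos_of_pos hγ
      have hR := rising_pos hγ n
      have h1u : 0 < 1 + u := by positivity
      rw [← ENNReal.ofReal_mul (by positivity), ← ENNReal.ofReal_mul hc]
      congr 1
      rw [Gamma_add_natCast hγ, Real.rpow_add h1u, Real.rpow_natCast,
        show γ + n - 1 = (γ - 1) + n by ring, Real.rpow_add hx, Real.rpow_natCast,
        Real.inv_rpow h1u.le, Real.one_rpow, show -((1 + u) * x) = -(1 * x) + -(u * x) by ring,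
        Real.exp_add, inv_pow]
      have := Real.rpow_pos_of_pos h1u γ
      field_simp
  rw [lintegral_congr_ae key, lintegral_const_mul _ (hpdf _ _),
    lintegral_gammaPDF_eq_one (by positivity) (by positivity), mul_one]

lemma lintegral_pi_prod {κ : Type*} [Fintype κ] {X : Type*} [MeasurableSpace X] (ν : Measure X)
    [IsProbabilityMeasure ν] (f : κ → X → ℝ≥0∞) (hf : ∀ k, Measurable (f k)) :
    ∫⁻ x, ∏ k, f k (x k) ∂(Measure.pi fun _ : κ ↦ ν) = ∏ k, ∫⁻ x, f k x ∂ν := by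
  rw [lintegral_prod_eq_prod_lintegral_of_indepFun Finset.univ (fun k (x : κ → X) ↦ f k (x k))
    (iIndepFun_pi (μ := fun _ ↦ ν) fun k ↦ (hf k).aemeasurable)
    (fun k ↦ (hf k).comp (measurable_pi_apply k))]
  refine Finset.prod_congr rfl fun k _ ↦ ?_
  exact (measurePreserving_eval (fun _ : κ ↦ ν) k).lintegral_comp (hf k)

lemma inv_pow_eq_lintegral {s : ℝ} (hs : 0 < s) {N : ℕ} (hN : 0 < N) :
    ENNReal.ofReal (s⁻¹ ^ N) = ENNReal.ofReal (Real.Gamma N)⁻¹ *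
      ∫⁻ u in Set.Ioi (0 : ℝ), ENNReal.ofReal (u ^ ((N : ℝ) - 1) * Real.exp (-(s * u))) := by
  have hN' : (0 : ℝ) < N := by exact_mod_cast hN
  have hG := Real.Gamma_pos_of_pos hN'
  rw [← ofReal_integral_eq_lintegral_ofReal]
  · rw [Real.integral_rpow_mul_exp_neg_mul_Ioi hN' hs, ← ENNReal.ofReal_mul (by positivity),
      one_div, Real.rpow_natCast]
    congr 1
    field_simp
  -- A non-integrable function has Bochner integral 0, so the nonzero value already proves
  -- integrability.
  · refine MeasureTheory.Integrable.of_integral_ne_zero ?_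
    rw [Real.integral_rpow_mul_exp_neg_mul_Ioi hN' hs]
    positivity
  · filter_upwards [ae_restrict_mem measurableSet_Ioi] with u hu
    have : (0 : ℝ) < u := hu
    positivity

lemma ae_pos_pi_gammaMeasure {κ : Type*} [Fintype κ] {γ : ℝ} (hγ : 0 < γ) :
    ∀ᵐ g ∂(Measure.pi fun _ : κ ↦ gammaMeasure γ 1), ∀ k, 0 < g k := by
  have := isProbabilityMeasure_gammaMeasure hγ one_pos
  have h : ∀ᵐ x ∂gammaMeasure γ 1, 0 < x := by
    have hpdf : Measurable (gammaPDF γ 1) := (measurable_gammaPDFReal γ 1).ennreal_ofReal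
    rw [gammaMeasure, ae_withDensity_iff hpdf]
    filter_upwards [Measure.ae_ne volume 0] with x hx h0
    by_contra hx'
    refine h0 ?_
    rw [gammaPDF_eq, if_neg (fun h ↦ hx' (lt_of_le_of_ne h hx.symm)), ENNReal.ofReal_zero]
  exact ae_all_iff.2 fun k ↦
    Measure.tendsto_eval_ae_ae (μ := fun _ : κ ↦ gammaMeasure γ 1) (i := k) h

/-- The normaliser (∑ g)^(-N) couples the Gamma variables. Writing it as Γ(N)⁻¹ ∫ u^(N-1) exp(-u ∑
g) du decouples them, and the powers of 1+u have total exponent N + γK whatever c is. Hence β does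
not depend on c and need not be evaluated. -/
lemma exists_lintegral_symmDirichlet (K : ℕ) {γ : ℝ} (hγ : 0 < γ) {N : ℕ} (hN : 0 < N) :
    ∃ β : ℝ≥0∞, ∀ c : Fin N → Fin K,
      ∫⁻ w, ∏ i, ENNReal.ofReal (w (c i)) ∂symmDirichlet K γ =
        ENNReal.ofReal (labelWeight γ c) * β := by
  have := isProbabilityMeasure_gammaMeasure hγ one_pos
  refine ⟨ENNReal.ofReal (Real.Gamma N)⁻¹ * ∫⁻ u in Set.Ioi (0 : ℝ),
    ENNReal.ofReal (u ^ ((N : ℝ) - 1)) *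
      ENNReal.ofReal ((1 + u)⁻¹ ^ N * ((1 + u)⁻¹ ^ γ) ^ K), fun c ↦ ?_⟩
  have hmeas1 : Measurable fun w : Fin K → ℝ ↦ ∏ i, ENNReal.ofReal (w (c i)) := by fun_prop
  have hmeas2 : Measurable fun (g : Fin K → ℝ) (k : Fin K) ↦ g k / ∑ l, g l := by fun_prop
  rw [symmDirichlet, lintegral_map hmeas1 hmeas2]
  have hpoint : ∀ᵐ g ∂(Measure.pi fun _ : Fin K ↦ gammaMeasure γ 1),
      ∏ i, ENNReal.ofReal (g (c i) / ∑ l, g l) = ENNReal.ofReal (Real.Gamma N)⁻¹ *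
        ∫⁻ u in Set.Ioi (0 : ℝ), ENNReal.ofReal (u ^ ((N : ℝ) - 1)) *
          ∏ k, ENNReal.ofReal (g k ^ (Finset.univ.filter fun i ↦ c i = k).card *
            Real.exp (-(u * g k))) := by
    filter_upwards [ae_pos_pi_gammaMeasure hγ] with g hg
    have hK : 0 < ∑ l, g l :=
      Finset.sum_pos (fun l _ ↦ hg l) ⟨c ⟨0, hN⟩, Finset.mem_univ _⟩
    have hprod : ∏ i, g (c i) = ∏ k, g k ^ (Finset.univ.filter fun i ↦ c i = k).card := by
      rw [← Finset.prod_fiberwise Finset.univ c]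
      refine Finset.prod_congr rfl fun k _ ↦ ?_
      rw [Finset.prod_congr rfl fun i hi ↦ by rw [(Finset.mem_filter.1 hi).2], Finset.prod_const]
    rw [← ENNReal.ofReal_prod_of_nonneg fun i _ ↦ (div_pos (hg _) hK).le]
    simp_rw [div_eq_mul_inv]
    rw [Finset.prod_mul_distrib, Finset.prod_const, Finset.card_univ, Fintype.card_fin, hprod,
      ENNReal.ofReal_mul (Finset.prod_nonneg fun k _ ↦ pow_nonneg (hg k).le _),
      inv_pow_eq_lintegral hK hN, mul_left_comm, ← lintegral_const_mul' _ _ ENNReal.ofReal_ne_top]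
    congr 1
    refine setLIntegral_congr_fun measurableSet_Ioi fun u hu ↦ ?_
    have hu' : 0 ≤ u ^ ((N : ℝ) - 1) := Real.rpow_nonneg (le_of_lt hu) _
    rw [← ENNReal.ofReal_prod_of_nonneg fun k _ ↦
        mul_nonneg (pow_nonneg (hg k).le _) (Real.exp_pos _).le,
      Finset.prod_mul_distrib, ← Real.exp_sum, Finset.sum_neg_distrib, ← Finset.mul_sum,
      ← ENNReal.ofReal_mul hu',
      ← ENNReal.ofReal_mul (Finset.prod_nonneg fun k _ ↦ pow_nonneg (hg k).le _)]
    congr 1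
    rw [mul_comm u]
    ring
  rw [lintegral_congr_ae hpoint, lintegral_const_mul' _ _ ENNReal.ofReal_ne_top, mul_left_comm,
    lintegral_lintegral_swap]
  swap
  · simp only [Function.uncurry_def]
    fun_prop
  congr 1
  rw [← lintegral_const_mul' _ _ ENNReal.ofReal_ne_top]
  refine setLIntegral_congr_fun measurableSet_Ioi fun u hu ↦ ?_
  have hu0 : 0 ≤ u := le_of_lt hu
  rw [lintegral_const_mul' _ _ ENNReal.ofReal_ne_top, mul_left_comm]
  congr 1
  have hm : ∀ k : Fin K, Measurable fun x : ℝ ↦ ENNReal.ofReal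
      (x ^ (Finset.univ.filter fun i ↦ c i = k).card * Real.exp (-(u * x))) := by fun_prop
  rw [lintegral_pi_prod (gammaMeasure γ 1) _ hm]
  simp_rw [lintegral_pow_mul_exp_gammaMeasure hγ hu0]
  rw [← ENNReal.ofReal_mul (labelWeight_pos hγ c).le, ← ENNReal.ofReal_prod_of_nonneg]
  · congr 1
    rw [Finset.prod_mul_distrib, Finset.prod_mul_distrib, Finset.prod_pow_eq_pow_sum,
      Finset.sum_card_fiberwise_eq_card_filter, Finset.prod_const]
    simp [labelWeight]
  · intro k _
    have := rising_pos hγ (Finset.univ.filter fun i ↦ c i = k).card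
    positivity

/-- Mixed moments of the symmetric Dirichlet law. -/
lemma lintegral_symmDirichlet {K : ℕ} (hK : 0 < K) {γ : ℝ} (hγ : 0 < γ) {N : ℕ} (hN : 0 < N)
    (c : Fin N → Fin K) :
    ∫⁻ w, ∏ i, ENNReal.ofReal (w (c i)) ∂symmDirichlet K γ =
      ENNReal.ofReal (labelWeight γ c / rising (γ * K) N) := by
  have := isProbabilityMeasure_gammaMeasure hγ one_pos
  have hK' : (0 : ℝ) < K := by exact_mod_cast hK
  have hR : 0 < rising (γ * K) N := rising_pos (by positivity) N
  obtain ⟨β, hβ⟩ := exists_lintegral_symmDirichlet K hγ hN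
  -- The constant β is determined by total mass: summed over all c, the monomials give (∑ w)^N = 1.
  have hsum : ∑ c : Fin N → Fin K, ∫⁻ w, ∏ i, ENNReal.ofReal (w (c i)) ∂symmDirichlet K γ = 1 := by
    have hmeas2 : Measurable fun (g : Fin K → ℝ) (k : Fin K) ↦ g k / ∑ l, g l := by fun_prop
    rw [← lintegral_finsetSum _ (fun c _ ↦ by fun_prop), symmDirichlet,
      lintegral_map (by fun_prop) hmeas2]
    have : ∀ᵐ g ∂(Measure.pi fun _ : Fin K ↦ gammaMeasure γ 1),
        ∑ c : Fin N → Fin K, ∏ i, ENNReal.ofReal (g (c i) / ∑ l, g l) = 1 := by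
      filter_upwards [ae_pos_pi_gammaMeasure hγ] with g hg
      have hS : 0 < ∑ l, g l := Finset.sum_pos (fun l _ ↦ hg l) ⟨⟨0, hK⟩, Finset.mem_univ _⟩
      rw [← Fintype.sum_pow (fun k ↦ ENNReal.ofReal (g k / ∑ l, g l)) N,
        ← ENNReal.ofReal_sum_of_nonneg fun k _ ↦ (div_pos (hg k) hS).le, ← Finset.sum_div,
        div_self hS.ne', ENNReal.ofReal_one, one_pow]
    rw [lintegral_congr_ae this, lintegral_one, measure_univ]
  simp_rw [hβ] at hsum
  rw [← Finset.sum_mul, ← ENNReal.ofReal_sum_of_nonneg fun c _ ↦ (labelWeight_pos hγ c).le,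
    sum_labelWeight, Fintype.card_fin, Fintype.card_fin, mul_comm] at hsum
  rw [hβ, ENNReal.eq_inv_of_mul_eq_one_left hsum, ← ENNReal.ofReal_inv_of_pos hR,
    ← ENNReal.ofReal_mul (labelWeight_pos hγ c).le, div_eq_mul_inv]

/-! ### Marginals of product measures -/

section Pi

variable {α β X : Type*} [Fintype α] [Fintype β] [MeasurableSpace X] (ν : Measure X)
  [IsProbabilityMeasure ν]

/-- The preimage of a box is a box with full sides off the range of e, and those sides have mass 1.
This is how the parameters of empty clusters disappear. -/
lemma map_comp_pi {e : α → β} (he : Function.Injective e) :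
    (Measure.pi fun _ : β ↦ ν).map (fun φ ↦ φ ∘ e) = Measure.pi fun _ : α ↦ ν := by
  classical
  have hm : Measurable fun φ : β → X ↦ φ ∘ e :=
    measurable_pi_lambda _ fun a ↦ measurable_pi_apply (e a)
  refine (Measure.pi_eq fun s hs ↦ ?_).symm
  rw [Measure.map_apply hm (MeasurableSet.univ_pi hs)]
  have hpre : (fun φ : β → X ↦ φ ∘ e) ⁻¹' Set.univ.pi s =
      Set.univ.pi (fun b ↦ if h : ∃ a, e a = b then s h.choose else Set.univ) := by
    ext φ
    simp only [Set.mem_preimage, Set.mem_univ_pi, Function.comp_apply]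
    constructor
    · intro h b
      split_ifs with hb
      · have := h hb.choose
        rwa [hb.choose_spec] at this
      · trivial
    · intro h a
      have h' := h (e a)
      have hb : ∃ a', e a' = e a := ⟨a, rfl⟩
      rw [dif_pos hb, he hb.choose_spec] at h'
      exact h'
  rw [hpre, Measure.pi_pi, ← Finset.prod_subset (Finset.subset_univ (Finset.univ.map ⟨e, he⟩))]
  · rw [Finset.prod_map]
    refine Finset.prod_congr rfl fun a _ ↦ ?_
    have hb : ∃ a', e a' = e a := ⟨a, rfl⟩
    simp only [Function.Embedding.coeFn_mk]
    rw [dif_pos hb, he hb.choose_spec]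
  · intro b _ hb
    have : ¬ ∃ a, e a = b := by simpa using hb
    rw [dif_neg this, measure_univ]

lemma lintegral_pi_comp {e : α → β} (he : Function.Injective e) {F : (α → X) → ℝ≥0∞}
    (hF : Measurable F) :
    ∫⁻ φ, F (φ ∘ e) ∂(Measure.pi fun _ : β ↦ ν) = ∫⁻ ψ, F ψ ∂(Measure.pi fun _ : α ↦ ν) := by
  have hm : Measurable fun φ : β → X ↦ φ ∘ e :=
    measurable_pi_lambda _ fun a ↦ measurable_pi_apply (e a)
  rw [← map_comp_pi ν he, lintegral_map hF hm]

lemma lintegral_pi_option {F : X × (α → X) → ℝ≥0∞} (hF : Measurable F) :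
    ∫⁻ ψ, F (ψ none, fun a ↦ ψ (some a)) ∂(Measure.pi fun _ : Option α ↦ ν) =
      ∫⁻ ψ, ∫⁻ x, F (x, ψ) ∂ν ∂(Measure.pi fun _ : α ↦ ν) := by
  have hm : Measurable fun ψ : Option α → X ↦ (ψ none, fun a ↦ ψ (some a)) := by fun_prop
  have h := Measure.pi_map_piOptionEquivProd (β := fun _ : Option α ↦ X) (fun _ ↦ ν)
  have h' := lintegral_map (μ := (Measure.pi fun _ : α ↦ ν).prod ν) (hF.comp hm)
    (MeasurableEquiv.piOptionEquivProd fun _ : Option α ↦ X).symm.measurable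
  rw [h] at h'
  refine h'.trans ?_
  exact lintegral_prod _ (hF.comp measurable_swap).aemeasurable

/-- Sending `none` to b extends e to an injection of `Option α`. Here b will be the label of a new
cluster, whose parameter is independent of the existing ones. -/
lemma lintegral_pi_comp_prod {e : α → β} (he : Function.Injective e) {b : β}
    (hb : b ∉ Set.range e) {F : X × (α → X) → ℝ≥0∞} (hF : Measurable F) :
    ∫⁻ φ, F (φ b, φ ∘ e) ∂(Measure.pi fun _ : β ↦ ν) =
      ∫⁻ ψ, ∫⁻ x, F (x, ψ) ∂ν ∂(Measure.pi fun _ : α ↦ ν) := by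
  have he' : Function.Injective fun o : Option α ↦ o.elim b e := by
    rintro (_ | a) (_ | a') h
    · rfl
    · exact (hb ⟨a', h.symm⟩).elim
    · exact (hb ⟨a, h⟩).elim
    · exact congrArg some (he h)
  have hm : Measurable fun ψ : Option α → X ↦ (ψ none, fun a ↦ ψ (some a)) := by fun_prop
  rw [← lintegral_pi_option ν hF]
  exact lintegral_pi_comp ν he' (hF.comp hm)

end Pi

/-! ### The coefficients `V_N(t)` -/

lemma pow_le_rising {x : ℝ} (hx : 0 < x) (n : ℕ) : x ^ n ≤ rising x n := by
  have h : x ^ n = ∏ _m ∈ Finset.range n, x := by simp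
  rw [h]
  exact Finset.prod_le_prod (fun _ _ ↦ hx.le) fun m _ ↦ by simp

/-- The real series `V` would have the default value 0 if it diverged, so summability is essential.
Since t ≤ N, the ratio is at most k^N / (γk)^N = γ^(-N). -/
lemma tsum_descFactorial_div_rising (pK : PMF ℕ+) {γ : ℝ} (hγ : 0 < γ) {N t : ℕ} (ht : t ≤ N) :
    ∑' k : ℕ+, pK k * ENNReal.ofReal (((k : ℕ).descFactorial t : ℝ) / rising (γ * ((k : ℕ) : ℝ)) N) =
      ENNReal.ofReal (V pK γ N t) := by
  have hR : ∀ k : ℕ+, 0 < rising (γ * ((k : ℕ) : ℝ)) N := fun k ↦ by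
    have : (0 : ℝ) < (k : ℕ) := by exact_mod_cast k.pos
    exact rising_pos (by positivity) N
  have hnn : ∀ k : ℕ+, 0 ≤ ((k : ℕ).descFactorial t : ℝ) / rising (γ * ((k : ℕ) : ℝ)) N *
      (pK k).toReal := fun k ↦ by
    have := hR k
    positivity
  have hle : ∀ k : ℕ+, ((k : ℕ).descFactorial t : ℝ) / rising (γ * ((k : ℕ) : ℝ)) N ≤
      (γ ^ N)⁻¹ := fun k ↦ by
    have hk : (1 : ℝ) ≤ (k : ℕ) := by exact_mod_cast k.pos
    have hk0 : (0 : ℝ) < (k : ℕ) := by linarith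
    have h1 : ((k : ℕ).descFactorial t : ℝ) ≤ ((k : ℕ) : ℝ) ^ t := by
      exact_mod_cast Nat.descFactorial_le_pow _ _
    have h2 := pow_le_rising (x := γ * ((k : ℕ) : ℝ)) (by positivity) N
    rw [mul_pow] at h2
    rw [div_le_iff₀ (hR k)]
    calc ((k : ℕ).descFactorial t : ℝ) ≤ ((k : ℕ) : ℝ) ^ N :=
          h1.trans (pow_le_pow_right₀ hk ht)
      _ = (γ ^ N)⁻¹ * (γ ^ N * ((k : ℕ) : ℝ) ^ N) := by
          have : 0 < γ ^ N := by positivity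
          field_simp
      _ ≤ _ := by gcongr
  have hsum : Summable fun k : ℕ+ ↦ ((k : ℕ).descFactorial t : ℝ) /
      rising (γ * ((k : ℕ) : ℝ)) N * (pK k).toReal := by
    refine Summable.of_nonneg_of_le hnn (fun k ↦ ?_)
      ((ENNReal.summable_toReal pK.tsum_coe_ne_top).mul_left (γ ^ N)⁻¹)
    exact mul_le_mul_of_nonneg_right (hle k) ENNReal.toReal_nonneg
  change _ = ENNReal.ofReal (∑' k : ℕ+, ((k : ℕ).descFactorial t : ℝ) /
      rising (γ * ((k : ℕ) : ℝ)) N * (pK k).toReal)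
  rw [ENNReal.ofReal_tsum_of_nonneg hnn hsum]
  refine tsum_congr fun k ↦ ?_
  rw [ENNReal.ofReal_mul' ENNReal.toReal_nonneg, ENNReal.ofReal_toReal (pK.apply_ne_top k),
    mul_comm]

lemma V_nonneg (pK : PMF ℕ+) {γ : ℝ} (hγ : 0 < γ) (N t : ℕ) : 0 ≤ V pK γ N t := by
  refine tsum_nonneg fun k ↦ mul_nonneg (div_nonneg (by positivity)
    (Finset.prod_nonneg fun m _ ↦ by positivity)) ENNReal.toReal_nonneg

/-- If V_N(t) = 0, no k in the support of `pK` reaches t, hence none reaches t+1. -/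
lemma V_succ_eq_zero (pK : PMF ℕ+) {γ : ℝ} (hγ : 0 < γ) {N t : ℕ} (ht : t + 1 ≤ N)
    (h : V pK γ N t = 0) : V pK γ N (t + 1) = 0 := by
  have h1 := tsum_descFactorial_div_rising pK hγ (Nat.le_of_succ_le ht)
  have h2 := tsum_descFactorial_div_rising pK hγ ht
  rw [h, ENNReal.ofReal_zero, ENNReal.tsum_eq_zero] at h1
  have h3 : ∑' k : ℕ+, pK k * ENNReal.ofReal
      (((k : ℕ).descFactorial (t + 1) : ℝ) / rising (γ * ((k : ℕ) : ℝ)) N) = 0 := by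
    refine ENNReal.tsum_eq_zero.2 fun k ↦ ?_
    rw [Nat.descFactorial_succ, Nat.cast_mul, mul_div_assoc,
      ENNReal.ofReal_mul (by positivity), mul_left_comm, h1 k, mul_zero]
  rw [h3] at h2
  exact le_antisymm (ENNReal.ofReal_eq_zero.1 h2.symm) (V_nonneg pK hγ N _)

/-! ### Partitions of the other individuals -/

section Partitions

variable {N : ℕ} {i : Fin N}

instance : Finite (Setoid (Others i)) :=
  Finite.of_injective (fun s : Setoid (Others i) ↦ s.r) fun _ _ h ↦
    Setoid.ext fun a b ↦ iff_of_eq (congrFun (congrFun h a) b)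

instance : Fintype (Setoid (Others i)) := Fintype.ofFinite _

lemma card_cluster_succ_le (s : Setoid (Others i)) : Fintype.card (Cluster s) + 1 ≤ N := by
  have h1 : Fintype.card (Cluster s) ≤ Fintype.card (Others i) :=
    Fintype.card_le_of_surjective _ (Quotient.mk_surjective (s := s))
  have h2 : Fintype.card (Others i) = N - 1 := by
    rw [Fintype.card_subtype_compl, Fintype.card_subtype_eq, Fintype.card_fin]
  have := i.pos
  omega

/-- The labellings with values in `κ` that induce the partition `s`. -/
def kerEqEquiv (κ : Type*) (s : Setoid (Others i)) :
    {c : Others i → κ // Setoid.ker c = s} ≃ (Cluster s ↪ κ) where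
  toFun c := ⟨Quotient.lift c.1 fun a b h ↦ by
      have h' : Setoid.ker c.1 a b := by rw [c.2]; exact h
      exact h', by
    rintro ⟨a⟩ ⟨b⟩ h
    refine Quotient.sound ?_
    change s a b
    rw [← c.2]
    exact h⟩
  invFun e := ⟨fun j ↦ e (Quotient.mk s j), Setoid.ext fun a b ↦ by
    rw [Setoid.ker_def, e.injective.eq_iff]
    exact Quotient.eq⟩
  left_inv c := rfl
  right_inv e := by
    ext ⟨a⟩
    rfl

/-- The labellings inducing a given partition are the injections of its blocks into the K labels. -/
lemma sum_ker (K : ℕ) (g : Setoid (Others i) → ℝ≥0∞) :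
    ∑ c : Others i → Fin K, g (Setoid.ker c) =
      ∑ s : Setoid (Others i), (K.descFactorial (Fintype.card (Cluster s)) : ℝ≥0∞) * g s := by
  classical
  rw [← Finset.sum_fiberwise Finset.univ (fun c : Others i → Fin K ↦ Setoid.ker c)]
  refine Finset.sum_congr rfl fun s _ ↦ ?_
  rw [Finset.sum_congr rfl fun c hc ↦ by rw [(Finset.mem_filter.1 hc).2], Finset.sum_const,
    nsmul_eq_mul, ← Fintype.card_subtype, Fintype.card_congr (kerEqEquiv (Fin K) s),
    Fintype.card_embedding_eq, Fintype.card_fin]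

open Classical in
/-- The cluster of an individual with label `l` when the others have labels `c`. -/
def choiceOfLabel {K : ℕ} (c : Others i → Fin K) (l : Fin K) : Option (Cluster (Setoid.ker c)) :=
  if h : ∃ k : Cluster (Setoid.ker c), Setoid.kerLift c k = l then some h.choose else none

lemma choiceOfLabel_kerLift {K : ℕ} (c : Others i → Fin K) (k : Cluster (Setoid.ker c)) :
    choiceOfLabel c (Setoid.kerLift c k) = some k := by
  have h : ∃ k', Setoid.kerLift c k' = Setoid.kerLift c k := ⟨k, rfl⟩
  rw [choiceOfLabel, dif_pos h, Setoid.kerLift_injective c h.choose_spec]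

lemma choiceOfLabel_eq_none {K : ℕ} (c : Others i → Fin K) {l : Fin K}
    (h : l ∉ Set.range (Setoid.kerLift c)) : choiceOfLabel c l = none :=
  dif_neg h

/-- Each existing cluster is chosen by exactly one label; all unused labels mean a new cluster. -/
lemma sum_choiceOfLabel {K : ℕ} (c : Others i → Fin K)
    (g : Option (Cluster (Setoid.ker c)) → ℝ≥0∞) :
    ∑ l, g (choiceOfLabel c l) = ∑ k, g (some k) +
      ((K - Fintype.card (Cluster (Setoid.ker c)) : ℕ) : ℝ≥0∞) * g none := by
  set S : Finset (Fin K) := Finset.univ.map ⟨Setoid.kerLift c, Setoid.kerLift_injective c⟩ with hS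
  rw [← Finset.sum_add_sum_compl S]
  congr 1
  · rw [hS, Finset.sum_map]
    exact Finset.sum_congr rfl fun k _ ↦ congrArg g (choiceOfLabel_kerLift c k)
  · rw [Finset.sum_congr rfl fun l hl ↦ by
      rw [choiceOfLabel_eq_none c (by rintro ⟨k, rfl⟩; simp [hS] at hl)], Finset.sum_const, nsmul_eq_mul,
      Finset.card_compl, hS, Finset.card_map, Finset.card_univ, Fintype.card_fin]

/-- The number of other individuals in the chosen cluster; `0` for a new cluster. -/
def choiceSize {s : Setoid (Others i)} : Option (Cluster s) → ℕ
  | some k => clusterSize k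
  | none => 0

/-- The product over the clusters of the rising factorials of `γ` of order the cluster size. -/
def partitionWeight (γ : ℝ) (s : Setoid (Others i)) : ℝ :=
  ∏ k : Cluster s, rising γ (clusterSize k)

lemma partitionWeight_pos {γ : ℝ} (hγ : 0 < γ) (s : Setoid (Others i)) :
    0 < partitionWeight γ s :=
  Finset.prod_pos fun _ _ ↦ rising_pos hγ _

lemma clusterSize_ker {K : ℕ} (c : Others i → Fin K) (k : Cluster (Setoid.ker c)) :
    clusterSize k = (Finset.univ.filter fun j ↦ c j = Setoid.kerLift c k).card := by
  rw [clusterSize, ← Set.ncard_coe_finset]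
  congr 1
  ext j
  simp only [Finset.coe_filter, Finset.mem_univ, true_and, Set.mem_ofPred_eq]
  rw [← Setoid.kerLift_mk c j, (Setoid.kerLift_injective c).eq_iff]

lemma card_filter_eq_zero {K : ℕ} (c : Others i → Fin K) {l : Fin K}
    (h : l ∉ Set.range (Setoid.kerLift c)) :
    (Finset.univ.filter fun j ↦ c j = l).card = 0 := by
  rw [Finset.card_eq_zero, Finset.filter_eq_empty_iff]
  intro j _ hj
  exact h ⟨Quotient.mk _ j, hj⟩

lemma choiceSize_choiceOfLabel {K : ℕ} (c : Others i → Fin K) (l : Fin K) :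
    choiceSize (choiceOfLabel c l) = (Finset.univ.filter fun j ↦ c j = l).card := by
  by_cases h : l ∈ Set.range (Setoid.kerLift c)
  · obtain ⟨k, rfl⟩ := h
    rw [choiceOfLabel_kerLift, choiceSize, clusterSize_ker]
  · rw [choiceOfLabel_eq_none c h, card_filter_eq_zero c h, choiceSize]

/-- Unused labels contribute empty rising factorials, equal to 1. -/
lemma labelWeight_eq_partitionWeight {K : ℕ} (γ : ℝ) (c : Others i → Fin K) :
    labelWeight γ c = partitionWeight γ (Setoid.ker c) := by
  rw [labelWeight, partitionWeight,
    ← Finset.prod_subset (Finset.subset_univ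
      (Finset.univ.map ⟨Setoid.kerLift c, Setoid.kerLift_injective c⟩)), Finset.prod_map]
  · exact Finset.prod_congr rfl fun k _ ↦ by rw [clusterSize_ker]; rfl
  · intro l _ hl
    rw [card_filter_eq_zero c (by rintro ⟨k, rfl⟩; simp at hl), rising_zero]

end Partitions

variable {N : ℕ} {L : Fin p → ℕ}

/-! ### Measurability of the likelihood -/

instance : SFinite (thresholdPrior L) := by
  unfold thresholdPrior
  infer_instance

/-- The indicator of the event that every latent vector lies in its hypercube. -/
def cubeIndicator (r : Latent N p × Obs N L × Thresholds L) : ℝ≥0∞ :=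
  open Classical in ∏ i, if InCube r.2.2 (r.2.1 i) (r.1 i) then 1 else 0

lemma measurable_cut {n : ℕ} (m : ℕ) : Measurable fun θ : Fin (n - 1) → ℝ ↦ cut θ m := by
  unfold cut
  split_ifs
  · exact measurable_const
  · exact measurable_coe_real_ereal.comp (measurable_pi_apply _)
  · exact measurable_const

lemma measurable_cubeIndicator :
    Measurable (cubeIndicator : Latent N p × Obs N L × Thresholds L → ℝ≥0∞) := by
  have h : ∀ x : Obs N L, Measurable fun y : Latent N p × Thresholds L ↦
      cubeIndicator (y.1, x, y.2) := fun x ↦ by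
    unfold cubeIndicator
    refine Finset.measurable_prod _ fun i _ ↦ Measurable.ite ?_ measurable_const measurable_const
    simp only [InCube, Set.ofPred_forall]
    refine MeasurableSet.iInter fun j ↦ MeasurableSet.inter ?_ ?_
    · exact measurableSet_le ((measurable_cut _).comp ((measurable_pi_apply j).comp measurable_snd))
        (measurable_coe_real_ereal.comp (by fun_prop))
    · exact measurableSet_lt (measurable_coe_real_ereal.comp (by fun_prop))
        ((measurable_cut _).comp ((measurable_pi_apply j).comp measurable_snd))
  have h' : Measurable fun y : (Latent N p × Thresholds L) × Obs N L ↦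
      cubeIndicator (y.1.1, y.2, y.1.2) := measurable_from_prod_countable_left h
  exact h'.comp (f := fun r : Latent N p × Obs N L × Thresholds L ↦ ((r.1, r.2.2), r.2.1))
    (by fun_prop)

lemma measurable_normalDensity_param {α : Type*} [MeasurableSpace α] {φ : α → ClusterParam p}
    {z : α → Fin p → ℝ} (hφ : Measurable φ) (hz : Measurable z) :
    Measurable fun a ↦ ENNReal.ofReal (normalDensity (φ a).2.2 (φ a).2.1 (z a)) := by
  have h := measurable_normalDensity.comp (f := fun a ↦ ((φ a).2.2, (φ a).2.1, z a)) (by fun_prop)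
  exact h.ennreal_ofReal

lemma likelihood_eq {K : ℕ} (θ : Thresholds L) (w : Fin K → ℝ) (c : Fin N → Fin K)
    (φ : Fin K → ClusterParam p) (z : Latent N p) (x : Obs N L) :
    likelihood (θ, w, c, φ, z, x) = (∏ i, ENNReal.ofReal (w (c i))) *
      ((∏ i, ENNReal.ofReal (normalDensity (φ (c i)).2.2 (φ (c i)).2.1 (z i))) *
        cubeIndicator (z, x, θ)) := by
  simp only [likelihood, cubeIndicator, Finset.prod_mul_distrib, mul_assoc]

/-- There are finitely many label vectors, so they can be frozen. This matters because the type of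
the data depends on the partition, hence on the labels. -/
lemma measurable_state {K : ℕ} {α : Type*} [MeasurableSpace α] {F : State N L K → α}
    (hF : ∀ c : Fin N → Fin K, Measurable fun y : ((Fin K → ℝ) × (Fin K → ClusterParam p) ×
      Latent N p × Obs N L × Thresholds L) ↦
        F (y.2.2.2.2, y.1, c, y.2.1, y.2.2.1, y.2.2.2.1)) : Measurable F := by
  have h := measurable_from_prod_countable_left (f := fun q : ((Fin K → ℝ) ×
    (Fin K → ClusterParam p) × Latent N p × Obs N L × Thresholds L) × (Fin N → Fin K) ↦
      F (q.1.2.2.2.2, q.1.1, q.2, q.1.2.1, q.1.2.2.1, q.1.2.2.2.1)) hF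
  exact h.comp (f := fun ω : State N L K ↦
    ((ω.2.1, ω.2.2.2.1, ω.2.2.2.2.1, ω.2.2.2.2.2, ω.1), ω.2.2.1)) (by fun_prop)

lemma measurable_prod_normalDensity {K : ℕ} (c : Fin N → Fin K) :
    Measurable fun y : (Fin K → ClusterParam p) × Latent N p ↦
      ∏ i, ENNReal.ofReal (normalDensity (y.1 (c i)).2.2 (y.1 (c i)).2.1 (y.2 i)) :=
  Finset.measurable_prod _ fun i _ ↦ measurable_normalDensity_param
    (φ := fun y : (Fin K → ClusterParam p) × Latent N p ↦ y.1 (c i)) (z := fun y ↦ y.2 i)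
    (by fun_prop) (by fun_prop)

lemma measurable_likelihood {K : ℕ} :
    Measurable (likelihood : State N L K → ℝ≥0∞) := by
  refine measurable_state fun c ↦ ?_
  simp only [likelihood_eq]
  refine Measurable.mul (by fun_prop) (Measurable.mul ?_ ?_)
  · exact (measurable_prod_normalDensity c).comp (f := fun y : ((Fin K → ℝ) ×
      (Fin K → ClusterParam p) × Latent N p × Obs N L × Thresholds L) ↦ (y.2.1, y.2.2.1))
      (by fun_prop)
  · exact measurable_cubeIndicator.comp (f := fun y : ((Fin K → ℝ) ×
      (Fin K → ClusterParam p) × Latent N p × Obs N L × Thresholds L) ↦ y.2.2) (by fun_prop)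

/-! ### Integrals against the model -/

lemma isProbabilityMeasure_symmDirichlet (K : ℕ) {γ : ℝ} (hγ : 0 < γ) :
    IsProbabilityMeasure (symmDirichlet K γ) := by
  have := isProbabilityMeasure_gammaMeasure hγ one_pos
  unfold symmDirichlet
  exact Measure.isProbabilityMeasure_map (by fun_prop)

/-- Reference measure of the latent variables, the observations and the thresholds. -/
def dataReference (N : ℕ) {p : ℕ} (L : Fin p → ℕ) : Measure (Latent N p × Obs N L × Thresholds L) :=
  (volume : Measure (Latent N p)).prod (Measure.count.prod (thresholdPrior L))

instance : SFinite (dataReference N L) := by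
  unfold dataReference
  infer_instance

/-- Fubini for the reference measure of the model, with the labels outermost. -/
lemma lintegral_reference {H : Hyper p} (hH : H.Valid) {K : ℕ} {F : State N L K → ℝ≥0∞}
    (hF : Measurable F) :
    ∫⁻ ω, F ω ∂((thresholdPrior L).prod ((symmDirichlet K H.γ).prod (Measure.count.prod
      ((Measure.pi fun _ : Fin K => clusterPrior H).prod
        ((volume : Measure (Latent N p)).prod Measure.count))))) =
    ∑ c : Fin N → Fin K, ∫⁻ w, ∫⁻ φ, ∫⁻ r, F (r.2.2, w, c, φ, r.1, r.2.1)
      ∂dataReference N L ∂(Measure.pi fun _ : Fin K => clusterPrior H) ∂symmDirichlet K H.γ := by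
  have := isProbabilityMeasure_symmDirichlet K hH.γ_pos
  have := isProbabilityMeasure_clusterPrior hH
  have : SFinite ((Measure.count : Measure (Fin N → Fin K)).prod
      ((Measure.pi fun _ : Fin K => clusterPrior H).prod
        ((volume : Measure (Latent N p)).prod (Measure.count : Measure (Obs N L))))) := inferInstance
  have : SFinite ((symmDirichlet K H.γ).prod ((Measure.count : Measure (Fin N → Fin K)).prod
      ((Measure.pi fun _ : Fin K => clusterPrior H).prod
        ((volume : Measure (Latent N p)).prod (Measure.count : Measure (Obs N L)))))) :=
    Measure.prod.instSFinite
  have hG : Measurable fun y ↦ ∫⁻ θ, F (θ, y) ∂thresholdPrior L := hF.lintegral_prod_left'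
  rw [lintegral_prod_symm' _ hF, lintegral_prod _ hG.aemeasurable]
  have hinner : ∀ w c φ, ∫⁻ r, F (r.2.2, w, c, φ, r.1, r.2.1) ∂dataReference N L =
      ∫⁻ y, ∫⁻ θ, F (θ, w, c, φ, y) ∂thresholdPrior L
        ∂((volume : Measure (Latent N p)).prod Measure.count) := fun w c φ ↦ by
    have h1 : Measurable fun r : Latent N p × Obs N L × Thresholds L ↦
        F (r.2.2, w, c, φ, r.1, r.2.1) := hF.comp (by fun_prop)
    have h2 : Measurable fun y : Latent N p × Obs N L ↦
        ∫⁻ θ, F (θ, w, c, φ, y) ∂thresholdPrior L :=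
      hG.comp (f := fun y ↦ (w, c, φ, y)) (by fun_prop)
    rw [dataReference, lintegral_prod _ h1.aemeasurable, lintegral_prod _ h2.aemeasurable]
    refine lintegral_congr fun z ↦ ?_
    exact lintegral_prod (fun y : Obs N L × Thresholds L ↦ F (y.2, w, c, φ, z, y.1))
      (hF.comp (by fun_prop)).aemeasurable
  have hc : ∀ (w : Fin K → ℝ) (c : Fin N → Fin K), ∫⁻ φ, ∫⁻ r, F (r.2.2, w, c, φ, r.1, r.2.1)
      ∂dataReference N L ∂(Measure.pi fun _ : Fin K => clusterPrior H) =
      ∫⁻ y, ∫⁻ θ, F (θ, w, c, y) ∂thresholdPrior L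
        ∂((Measure.pi fun _ : Fin K => clusterPrior H).prod
        ((volume : Measure (Latent N p)).prod Measure.count)) := fun w c ↦ by
    simp_rw [hinner]
    refine (lintegral_prod (fun y : (Fin K → ClusterParam p) × Latent N p × Obs N L ↦
      ∫⁻ θ, F (θ, w, c, y) ∂thresholdPrior L) (Measurable.aemeasurable ?_)).symm
    exact hG.comp (f := fun y ↦ (w, c, y)) (by fun_prop)
  simp_rw [hc]
  rw [← lintegral_finsetSum]
  · refine lintegral_congr fun w ↦ ?_
    rw [lintegral_prod (fun y : (Fin N → Fin K) × (Fin K → ClusterParam p) × Latent N p × Obs N L ↦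
      ∫⁻ θ, F (θ, w, y) ∂thresholdPrior L)
      (hG.comp (f := fun y ↦ (w, y)) (by fun_prop)).aemeasurable, lintegral_count, tsum_fintype]
  · intro c _
    exact Measurable.lintegral_prod_right' (f := fun q : (Fin K → ℝ) ×
      (Fin K → ClusterParam p) × Latent N p × Obs N L ↦ ∫⁻ θ, F (θ, q.1, c, q.2) ∂thresholdPrior L)
      (hG.comp (f := fun q : (Fin K → ℝ) × (Fin K → ClusterParam p) × Latent N p × Obs N L ↦
        (q.1, c, q.2)) (by fun_prop))

/-! ### Integrating out the parameters of the empty clusters -/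

variable {i : Fin N}

/-- The likelihood of the other individuals and of all observations, given the data. -/
def otherLikelihood (s : Setoid (Others i)) (d : Data N L s) : ℝ≥0∞ :=
  (∏ j : Others i, ENNReal.ofReal (normalDensity (d.1 (Quotient.mk s j)).2.2
    (d.1 (Quotient.mk s j)).2.1 (d.2.1 j))) * cubeIndicator d.2

/-- The likelihood of individual `i` in the chosen cluster. -/
def choiceLikelihood (H : Hyper p) (s : Setoid (Others i)) (d : Data N L s) :
    Option (Cluster s) → ℝ≥0∞
  | some k => ENNReal.ofReal (normalDensity (d.1 k).2.2 (d.1 k).2.1 (d.2.1 i))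
  | none => ENNReal.ofReal (mNew H (d.2.1 i))

/-- Reference measure of the data. -/
def clusterReference (L : Fin p → ℕ) (H : Hyper p) (s : Setoid (Others i)) :
    Measure (Data N L s) :=
  (Measure.pi fun _ : Cluster s ↦ clusterPrior H).prod (dataReference N L)

lemma measurable_otherLikelihood (s : Setoid (Others i)) :
    Measurable (otherLikelihood s : Data N L s → ℝ≥0∞) := by
  refine Measurable.mul (Finset.measurable_prod _ fun j _ ↦ ?_)
    (measurable_cubeIndicator.comp measurable_snd)
  exact measurable_normalDensity_param (φ := fun d : Data N L s ↦ d.1 (Quotient.mk s j))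
    (z := fun d ↦ d.2.1 j) (by fun_prop) (by fun_prop)

lemma measurable_normalDensity_data (s : Setoid (Others i)) (k : Cluster s) :
    Measurable fun d : Data N L s ↦ normalDensity (d.1 k).2.2 (d.1 k).2.1 (d.2.1 i) :=
  measurable_normalDensity.comp (f := fun d : Data N L s ↦
    ((d.1 k).2.2, (d.1 k).2.1, d.2.1 i)) (by fun_prop)

lemma measurable_choiceLikelihood {H : Hyper p} (hH : H.Valid) (s : Setoid (Others i))
    (o : Option (Cluster s)) : Measurable fun d : Data N L s ↦ choiceLikelihood H s d o := by
  cases o with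
  | none =>
    exact ((measurable_mNew hH).comp (f := fun d : Data N L s ↦ d.2.1 i)
      (by fun_prop)).ennreal_ofReal
  | some k => exact (measurable_normalDensity_data s k).ennreal_ofReal

/-- Separate the factor of `i`. If its label is in use, the integrand involves only parameters of
existing clusters. Otherwise its parameter is an independent draw from the prior and enters that
factor alone, so it integrates to m(z_i). -/
lemma lintegral_parameters {H : Hyper p} (hH : H.Valid) {K : ℕ} (c : Fin N → Fin K)
    {f : ∀ s : Setoid (Others i), Option (Cluster s) → Data N L s → ℝ≥0∞}
    (hf : ∀ s k, Measurable (f s k)) :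
    ∫⁻ φ, ∫⁻ r, (∏ j, ENNReal.ofReal (normalDensity (φ (c j)).2.2 (φ (c j)).2.1 (r.1 j))) *
      cubeIndicator r * f (Setoid.ker fun j : Others i ↦ c j)
        (choiceOfLabel (fun j : Others i ↦ c j) (c i))
        (fun k ↦ φ (Setoid.kerLift (fun j : Others i ↦ c j) k), r)
      ∂dataReference N L ∂(Measure.pi fun _ : Fin K => clusterPrior H) =
    ∫⁻ d, otherLikelihood _ d *
        choiceLikelihood H _ d (choiceOfLabel (fun j : Others i ↦ c j) (c i)) *
      f (Setoid.ker fun j : Others i ↦ c j) (choiceOfLabel (fun j : Others i ↦ c j) (c i)) d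
      ∂clusterReference L H (Setoid.ker fun j : Others i ↦ c j) := by
  have := isProbabilityMeasure_clusterPrior hH
  set c' : Others i → Fin K := fun j ↦ c j with hc'
  have hinj := Setoid.kerLift_injective c'
  have hint : ∀ (φ : Fin K → ClusterParam p) (r : Latent N p × Obs N L × Thresholds L),
      (∏ j, ENNReal.ofReal (normalDensity (φ (c j)).2.2 (φ (c j)).2.1 (r.1 j))) *
        cubeIndicator r =
      ENNReal.ofReal (normalDensity (φ (c i)).2.2 (φ (c i)).2.1 (r.1 i)) *
        otherLikelihood (Setoid.ker c') (φ ∘ Setoid.kerLift c', r) := fun φ r ↦ by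
    rw [Fintype.prod_eq_mul_prod_subtype_ne _ i, mul_assoc]
    rfl
  simp_rw [hint]
  have hmeas : ∀ o, Measurable fun d : Data N L (Setoid.ker c') ↦
      otherLikelihood _ d * choiceLikelihood H _ d o * f (Setoid.ker c') o d := fun o ↦
    ((measurable_otherLikelihood _).mul (measurable_choiceLikelihood hH _ o)).mul (hf _ o)
  rw [clusterReference, lintegral_prod _ (hmeas _).aemeasurable]
  by_cases h : c i ∈ Set.range (Setoid.kerLift c')
  · obtain ⟨k, hk⟩ := h
    rw [← hk, choiceOfLabel_kerLift]
    rw [← lintegral_pi_comp (clusterPrior H) hinj (hmeas (some k)).lintegral_prod_right']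
    refine lintegral_congr fun φ ↦ lintegral_congr fun r ↦ ?_
    rw [mul_comm (ENNReal.ofReal _)]
    rfl
  · rw [choiceOfLabel_eq_none c' h]
    have hF : Measurable fun q : (ClusterParam p × (Cluster (Setoid.ker c') → ClusterParam p)) ×
        (Latent N p × Obs N L × Thresholds L) ↦
        ENNReal.ofReal (normalDensity q.1.1.2.2 q.1.1.2.1 (q.2.1 i)) *
          otherLikelihood (Setoid.ker c') (q.1.2, q.2) * f (Setoid.ker c') none (q.1.2, q.2) := by
      refine Measurable.mul (Measurable.mul ?_ ?_) ?_
      · exact measurable_normalDensity_param (φ := fun q : (ClusterParam p ×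
          (Cluster (Setoid.ker c') → ClusterParam p)) ×
          (Latent N p × Obs N L × Thresholds L) ↦ q.1.1) (z := fun q ↦ q.2.1 i)
          (by fun_prop) (by fun_prop)
      · exact (measurable_otherLikelihood _).comp (f := fun q : (ClusterParam p ×
          (Cluster (Setoid.ker c') → ClusterParam p)) ×
          (Latent N p × Obs N L × Thresholds L) ↦ (q.1.2, q.2)) (by fun_prop)
      · exact (hf _ none).comp (f := fun q : (ClusterParam p ×
          (Cluster (Setoid.ker c') → ClusterParam p)) ×
          (Latent N p × Obs N L × Thresholds L) ↦ (q.1.2, q.2)) (by fun_prop)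
    refine (lintegral_pi_comp_prod (clusterPrior H) hinj h hF.lintegral_prod_right').trans ?_
    refine lintegral_congr fun ψ ↦ ?_
    rw [lintegral_lintegral_swap]
    · refine lintegral_congr fun r ↦ ?_
      have hx : Measurable fun x : ClusterParam p ↦
          ENNReal.ofReal (normalDensity x.2.2 x.2.1 (r.1 i)) :=
        measurable_normalDensity_param measurable_id measurable_const
      simp_rw [mul_assoc]
      rw [lintegral_mul_const _ hx, lintegral_normalDensity_clusterPrior hH, mul_left_comm]
      rfl
    · exact (hF.comp (f := fun q : ClusterParam p × (Latent N p × Obs N L × Thresholds L) ↦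
        ((q.1, ψ), q.2)) (by fun_prop)).aemeasurable


/-! ### Integrals of functions of the partition, the cluster of `i` and the data -/

lemma measurable_sigma_dom {ι α : Type*} {β : ι → Type*} [∀ k, MeasurableSpace (β k)]
    [MeasurableSpace α] {F : (Σ k, β k) → α} (hF : ∀ k, Measurable fun x ↦ F ⟨k, x⟩) :
    Measurable F := fun _ hs ↦
  MeasurableSpace.measurableSet_iInf.2 fun k ↦ hF k hs

lemma measurable_sigma_mk {ι : Type*} {β : ι → Type*} [∀ k, MeasurableSpace (β k)] (k : ι) :
    Measurable (Sigma.mk k : β k → Σ k, β k) := fun _ hs ↦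
  MeasurableSpace.measurableSet_iInf.1 hs k

/-- Rewrites the partition, choice and data of a state in terms of its labels, so that the dependent
types involve only `Setoid.ker` of those labels. -/
lemma comp_state_eq (f : ∀ s : Setoid (Others i), Option (Cluster s) → Data N L s → ℝ≥0∞) (K : ℕ+)
    (θ : Thresholds L) (w : Fin K → ℝ) (c : Fin N → Fin K) (φ : Fin K → ClusterParam p)
    (z : Latent N p) (x : Obs N L) :
    f (partitionOf i ⟨K, (θ, w, c, φ, z, x)⟩) (choiceOf i ⟨K, (θ, w, c, φ, z, x)⟩)
        (dataOf i ⟨K, (θ, w, c, φ, z, x)⟩) =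
      f (Setoid.ker fun j : Others i ↦ c j) (choiceOfLabel (fun j : Others i ↦ c j) (c i))
        (fun k ↦ φ (Setoid.kerLift (fun j : Others i ↦ c j) k), z, x, θ) := by
  have h : choiceOf i ⟨K, (θ, w, c, φ, z, x)⟩ =
      choiceOfLabel (fun j : Others i ↦ c j) (c i) := by
    unfold choiceOf choiceOfLabel
    congr
  rw [h]
  rfl

lemma measurable_comp_state {f : ∀ s : Setoid (Others i), Option (Cluster s) → Data N L s → ℝ≥0∞}
    (hf : ∀ s k, Measurable (f s k)) (K : ℕ+) :
    Measurable fun ω : State N L K ↦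
      f (partitionOf i ⟨K, ω⟩) (choiceOf i ⟨K, ω⟩) (dataOf i ⟨K, ω⟩) := by
  refine measurable_state fun c ↦ ?_
  simp only [comp_state_eq]
  exact (hf (Setoid.ker fun j : Others i ↦ c j)
    (choiceOfLabel (fun j : Others i ↦ c j) (c i))).comp
    (f := fun y : ((Fin K → ℝ) × (Fin K → ClusterParam p) × Latent N p × Obs N L × Thresholds L) ↦
      (fun k ↦ y.2.1 (Setoid.kerLift (fun j : Others i ↦ c j) k), y.2.2)) (by fun_prop)

/-- The integral against the law of the data when `i` has made the choice `o`. -/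
def choiceIntegral (H : Hyper p)
    (f : ∀ s : Setoid (Others i), Option (Cluster s) → Data N L s → ℝ≥0∞)
    (s : Setoid (Others i)) (o : Option (Cluster s)) : ℝ≥0∞ :=
  ∫⁻ d, otherLikelihood s d * choiceLikelihood H s d o * f s o d ∂clusterReference L H s

/-- The number of nonempty clusters once `i` has made the choice `o`. -/
def choiceRank {s : Setoid (Others i)} : Option (Cluster s) → ℕ
  | some _ => Fintype.card (Cluster s)
  | none => Fintype.card (Cluster s) + 1

lemma choiceRank_le {s : Setoid (Others i)} (o : Option (Cluster s)) : choiceRank o ≤ N := by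
  have := card_cluster_succ_le s
  cases o with
  | none => exact this
  | some k => exact Nat.le_of_succ_le this

lemma lintegral_modelGiven_eq_sum_labels {H : Hyper p} (hH : H.Valid)
    {f : ∀ s : Setoid (Others i), Option (Cluster s) → Data N L s → ℝ≥0∞}
    (hf : ∀ s k, Measurable (f s k)) (K : ℕ+) :
    ∫⁻ ω, f (partitionOf i ⟨K, ω⟩) (choiceOf i ⟨K, ω⟩) (dataOf i ⟨K, ω⟩) ∂modelGiven N L H K =
      ∑ c : Fin N → Fin K, ENNReal.ofReal (labelWeight H.γ c / rising (H.γ * ((K : ℕ) : ℝ)) N) *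
        choiceIntegral H f (Setoid.ker fun j : Others i ↦ c j)
          (choiceOfLabel (fun j : Others i ↦ c j) (c i)) := by
  have hΦ := measurable_comp_state hf K
  rw [modelGiven, lintegral_withDensity_eq_lintegral_mul _ measurable_likelihood hΦ,
    lintegral_reference hH (measurable_likelihood.mul hΦ)]
  refine Finset.sum_congr rfl fun c _ ↦ ?_
  rw [← lintegral_symmDirichlet K.pos hH.γ_pos i.pos c, choiceIntegral,
    ← lintegral_parameters hH c hf, ← lintegral_mul_const _ (by fun_prop)]
  refine lintegral_congr fun w ↦ ?_
  have hw : ∏ i, ENNReal.ofReal (w (c i)) ≠ ⊤ := ENNReal.prod_ne_top fun _ _ ↦ ENNReal.ofReal_ne_top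
  rw [← lintegral_const_mul' _ _ hw]
  refine lintegral_congr fun φ ↦ ?_
  rw [← lintegral_const_mul' _ _ hw]
  refine lintegral_congr fun r ↦ ?_
  rw [Pi.mul_apply, likelihood_eq, mul_assoc, comp_state_eq f]

/-- The summand over label vectors depends only on the induced partition and choice, so labellings
are grouped by these and counted. -/
lemma lintegral_modelGiven_eq_sum {H : Hyper p} (hH : H.Valid)
    {f : ∀ s : Setoid (Others i), Option (Cluster s) → Data N L s → ℝ≥0∞}
    (hf : ∀ s k, Measurable (f s k)) (K : ℕ+) :
    ∫⁻ ω, f (partitionOf i ⟨K, ω⟩) (choiceOf i ⟨K, ω⟩) (dataOf i ⟨K, ω⟩) ∂modelGiven N L H K =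
      ∑ s : Setoid (Others i), ∑ o : Option (Cluster s),
        ENNReal.ofReal (((K : ℕ).descFactorial (choiceRank o) : ℝ) /
          rising (H.γ * ((K : ℕ) : ℝ)) N) *
        (ENNReal.ofReal (partitionWeight H.γ s * (choiceSize o + H.γ)) *
          choiceIntegral H f s o) := by
  have hγ := hH.γ_pos
  have hK : (0 : ℝ) < (K : ℕ) := by exact_mod_cast K.pos
  have hR : 0 < rising (H.γ * ((K : ℕ) : ℝ)) N := rising_pos (by positivity) N
  let g : ∀ s : Setoid (Others i), Option (Cluster s) → ℝ≥0∞ := fun s o ↦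
    ENNReal.ofReal (partitionWeight H.γ s * (choiceSize o + H.γ) /
      rising (H.γ * ((K : ℕ) : ℝ)) N) * choiceIntegral H f s o
  have h1 : ∀ c : Fin N → Fin K,
      ENNReal.ofReal (labelWeight H.γ c / rising (H.γ * ((K : ℕ) : ℝ)) N) *
        choiceIntegral H f (Setoid.ker fun j : Others i ↦ c j)
          (choiceOfLabel (fun j : Others i ↦ c j) (c i)) =
      (fun q : Fin K × (Others i → Fin K) ↦ g (Setoid.ker q.2) (choiceOfLabel q.2 q.1))
        (Equiv.funSplitAt i (Fin K) c) := fun c ↦ by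
    change _ = g (Setoid.ker fun j : Others i ↦ c j)
      (choiceOfLabel (fun j : Others i ↦ c j) (c i))
    simp only [g]
    rw [labelWeight_eq_mul H.γ c i, choiceSize_choiceOfLabel, ← labelWeight_eq_partitionWeight,
      add_comm H.γ]
  rw [lintegral_modelGiven_eq_sum_labels hH hf K, Finset.sum_congr rfl fun c _ ↦ h1 c]
  refine (Equiv.sum_comp (Equiv.funSplitAt i (Fin K)) fun q : Fin K × (Others i → Fin K) ↦
    g (Setoid.ker q.2) (choiceOfLabel q.2 q.1)).trans ?_
  rw [Fintype.sum_prod_type_right]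
  have h2 : ∀ c : Others i → Fin K, ∑ l, g (Setoid.ker c) (choiceOfLabel c l) =
      (fun s ↦ ∑ k, g s (some k) + (((K : ℕ) - Fintype.card (Cluster s) : ℕ) : ℝ≥0∞) * g s none)
        (Setoid.ker c) := fun c ↦ sum_choiceOfLabel c (g (Setoid.ker c))
  rw [Finset.sum_congr rfl fun c _ ↦ h2 c]
  refine (sum_ker K fun s ↦ ∑ k, g s (some k) +
    (((K : ℕ) - Fintype.card (Cluster s) : ℕ) : ℝ≥0∞) * g s none).trans ?_
  refine Finset.sum_congr rfl fun s _ ↦ ?_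
  have hpw := partitionWeight_pos hγ s
  have h3 : ∀ o : Option (Cluster s),
      ENNReal.ofReal (((K : ℕ).descFactorial (choiceRank o) : ℝ) /
          rising (H.γ * ((K : ℕ) : ℝ)) N) *
        (ENNReal.ofReal (partitionWeight H.γ s * (choiceSize o + H.γ)) *
          choiceIntegral H f s o) = ((K : ℕ).descFactorial (choiceRank o) : ℝ≥0∞) * g s o :=
    fun o ↦ by
      simp only [g]
      have hA : 0 ≤ partitionWeight H.γ s * (choiceSize o + H.γ) := by positivity
      generalize partitionWeight H.γ s * (choiceSize o + H.γ) = A at hA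
      rw [div_eq_mul_inv, div_eq_mul_inv, ENNReal.ofReal_mul (by positivity),
        ENNReal.ofReal_mul (by positivity), ENNReal.ofReal_natCast]
      ring
  simp_rw [h3]
  rw [Fintype.sum_option, mul_add, Finset.mul_sum, add_comm, ← mul_assoc]
  congr 2
  -- The K-t labels available to a new cluster extend the falling factorial from t to t+1 factors.
  rw [choiceRank, Nat.descFactorial_succ, Nat.cast_mul, mul_comm]

/-- The joint weight of the choice `o` and of the data, up to the likelihood of the others. -/
def jointWeight (H : Hyper p) (s : Setoid (Others i)) (d : Data N L s)
    (o : Option (Cluster s)) : ℝ≥0∞ :=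
  ENNReal.ofReal (V H.pK H.γ N (choiceRank o)) *
    (ENNReal.ofReal (partitionWeight H.γ s * (choiceSize o + H.γ)) * choiceLikelihood H s d o)

/-- The joint law of the partition, of the cluster of `i` and of the data. -/
lemma lintegral_model {H : Hyper p} (hH : H.Valid)
    {f : ∀ s : Setoid (Others i), Option (Cluster s) → Data N L s → ℝ≥0∞}
    (hf : ∀ s k, Measurable (f s k)) :
    ∫⁻ ω, f (partitionOf i ω) (choiceOf i ω) (dataOf i ω) ∂model N L H =
      ∑ s : Setoid (Others i), ∫⁻ d, otherLikelihood s d * ∑ o, jointWeight H s d o * f s o d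
        ∂clusterReference L H s := by
  have hΦ : Measurable fun ω : Σ K : ℕ+, State N L K ↦
      f (partitionOf i ω) (choiceOf i ω) (dataOf i ω) :=
    measurable_sigma_dom (measurable_comp_state hf)
  rw [model, lintegral_sum_measure]
  simp_rw [lintegral_smul_measure, lintegral_map hΦ (measurable_sigma_mk _),
    lintegral_modelGiven_eq_sum hH hf, smul_eq_mul, Finset.mul_sum]
  rw [Summable.tsum_finsetSum fun _ _ ↦ ENNReal.summable]
  refine Finset.sum_congr rfl fun s _ ↦ ?_
  have hmeas : ∀ o, Measurable fun d : Data N L s ↦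
      otherLikelihood s d * (jointWeight H s d o * f s o d) := fun o ↦
    (measurable_otherLikelihood s).mul
      ((((measurable_choiceLikelihood hH s o).const_mul _).const_mul _).mul (hf s o))
  rw [Summable.tsum_finsetSum fun _ _ ↦ ENNReal.summable, lintegral_finsetSum _ fun o _ ↦ hmeas o]
  refine Finset.sum_congr rfl fun o _ ↦ ?_
  simp_rw [← mul_assoc]
  -- Only the ratio of falling to rising factorial depends on K; its average is V_N at the number of
  -- nonempty clusters.
  rw [ENNReal.tsum_mul_right, ENNReal.tsum_mul_right,
    tsum_descFactorial_div_rising H.pK hH.γ_pos (choiceRank_le o), choiceIntegral,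
    ← lintegral_const_mul' _ _ (ENNReal.mul_ne_top ENNReal.ofReal_ne_top ENNReal.ofReal_ne_top)]
  refine lintegral_congr fun d ↦ ?_
  rw [jointWeight]
  ring

/-! ### The full conditional law -/

lemma weight_nonneg {H : Hyper p} (hH : H.Valid) (s : Setoid (Others i)) (d : Data N L s)
    (o : Option (Cluster s)) : 0 ≤ weight H i s d o := by
  have hγ := hH.γ_pos
  cases o with
  | none =>
    exact mul_nonneg (mul_nonneg hγ.le (div_nonneg (V_nonneg _ hγ _ _) (V_nonneg _ hγ _ _)))
      (mNew_nonneg hH _)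
  | some k => exact mul_nonneg (by positivity) (normalDensity_nonneg _ _ _)

lemma measurable_weight {H : Hyper p} (hH : H.Valid) (s : Setoid (Others i))
    (o : Option (Cluster s)) : Measurable fun d : Data N L s ↦ weight H i s d o := by
  cases o with
  | none =>
    exact ((measurable_mNew hH).comp (f := fun d : Data N L s ↦ d.2.1 i)
      (by fun_prop)).const_mul _
  | some k => exact (measurable_normalDensity_data s k).const_mul _

/-- Dividing by V_N(t), which is common to all choices, leaves 1 for an existing cluster and
V_N(t+1)/V_N(t) for a new one. -/
lemma jointWeight_eq_mul_weight {H : Hyper p} (hH : H.Valid) (s : Setoid (Others i))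
    (d : Data N L s) (hV : 0 < V H.pK H.γ N (Fintype.card (Cluster s))) (o : Option (Cluster s)) :
    jointWeight H s d o =
      ENNReal.ofReal (partitionWeight H.γ s * V H.pK H.γ N (Fintype.card (Cluster s))) *
        ENNReal.ofReal (weight H i s d o) := by
  have hγ := hH.γ_pos
  have hpw := partitionWeight_pos hγ s
  rw [← ENNReal.ofReal_mul (by positivity)]
  cases o with
  | none =>
    rw [jointWeight, choiceLikelihood, choiceSize, choiceRank, weight,
      ← ENNReal.ofReal_mul (by positivity), ← ENNReal.ofReal_mul (V_nonneg _ hγ _ _)]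
    congr 1
    push_cast
    field_simp
    ring
  | some k =>
    rw [jointWeight, choiceLikelihood, choiceSize, choiceRank, weight,
      ← ENNReal.ofReal_mul (by positivity), ← ENNReal.ofReal_mul (V_nonneg _ hγ _ _)]
    congr 1
    ring

lemma jointWeight_eq_zero {H : Hyper p} (hH : H.Valid) (s : Setoid (Others i))
    (d : Data N L s) (hV : V H.pK H.γ N (Fintype.card (Cluster s)) = 0) (o : Option (Cluster s)) :
    jointWeight H s d o = 0 := by
  have : V H.pK H.γ N (choiceRank o) = 0 := by
    cases o with
    | none => exact V_succ_eq_zero _ hH.γ_pos (card_cluster_succ_le s) hV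
    | some k => exact hV
  rw [jointWeight, this, ENNReal.ofReal_zero, zero_mul]

/-- Either all joint weights vanish or the weights can be normalised. -/
lemma jointWeight_eq_zero_or {H : Hyper p} (hH : H.Valid) (s : Setoid (Others i))
    (d : Data N L s) : (∀ o, jointWeight H s d o = 0) ∨
      (0 < V H.pK H.γ N (Fintype.card (Cluster s)) ∧ 0 < ∑ l, weight H i s d l) := by
  rcases (V_nonneg H.pK hH.γ_pos N (Fintype.card (Cluster s))).eq_or_lt with hV | hV
  · exact Or.inl (jointWeight_eq_zero hH s d hV.symm)
  · rcases (Finset.sum_nonneg fun o _ ↦ weight_nonneg hH s d o).eq_or_lt with hW | hW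
    · refine Or.inl fun o ↦ ?_
      rw [jointWeight_eq_mul_weight hH s d hV, (Finset.sum_eq_zero_iff_of_nonneg
        fun o _ ↦ weight_nonneg hH s d o).1 hW.symm o (Finset.mem_univ o), ENNReal.ofReal_zero,
        mul_zero]
    · exact Or.inr ⟨hV, hW⟩

lemma sum_normalised_weight {H : Hyper p} (hH : H.Valid) (s : Setoid (Others i))
    (d : Data N L s) (hW : 0 < ∑ l, weight H i s d l) :
    ∑ o, ENNReal.ofReal (weight H i s d o / ∑ l, weight H i s d l) = 1 := by
  rw [← ENNReal.ofReal_sum_of_nonneg fun o _ ↦ div_nonneg (weight_nonneg hH s d o) hW.le,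
    ← Finset.sum_div, div_self hW.ne', ENNReal.ofReal_one]

/-- Total mass times conditional probability is joint mass. It also holds where normalisation fails,
since all joint weights are then 0. -/
lemma sum_jointWeight_mul {H : Hyper p} (hH : H.Valid) (s : Setoid (Others i))
    (d : Data N L s) (o : Option (Cluster s)) :
    (∑ l, jointWeight H s d l) *
      ENNReal.ofReal (weight H i s d o / ∑ l, weight H i s d l) = jointWeight H s d o := by
  rcases jointWeight_eq_zero_or hH s d with h | ⟨hV, hW⟩
  · simp [h]
  · simp_rw [jointWeight_eq_mul_weight hH s d hV]
    rw [← Finset.mul_sum, ← ENNReal.ofReal_sum_of_nonneg fun o _ ↦ weight_nonneg hH s d o,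
      mul_assoc, ← ENNReal.ofReal_mul hW.le, mul_div_cancel₀ _ hW.ne']

end MFMPGM
end

theorem proposition3p1 {N p : ℕ} (L : Fin p → ℕ) (hL : ∀ j, 1 ≤ L j)
    (H : MFMPGM.Hyper p) (hH : H.Valid) (i : Fin N) :
    MFMPGM.IsFullConditional i (MFMPGM.model N L H)
      (fun s d k => ENNReal.ofReal
        (MFMPGM.weight H i s d k / ∑ l, MFMPGM.weight H i s d l)) := by
  have hκ : ∀ (s : Setoid (MFMPGM.Others i)) (k : Option (MFMPGM.Cluster s)),
      Measurable fun d : MFMPGM.Data N L s ↦ ENNReal.ofReal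
        (MFMPGM.weight H i s d k / ∑ l, MFMPGM.weight H i s d l) := fun s k ↦
    ((MFMPGM.measurable_weight hH s k).div
      (Finset.measurable_sum _ fun l _ ↦ MFMPGM.measurable_weight hH s l)).ennreal_ofReal
  refine ⟨hκ, ?_, fun f hf ↦ ?_⟩
  · classical
    -- The indicator that the probabilities do not sum to 1. Wherever it is nonzero all joint
    -- weights vanish, so its integral is 0.
    let f : ∀ s : Setoid (MFMPGM.Others i), Option (MFMPGM.Cluster s) →
        MFMPGM.Data N L s → ℝ≥0∞ := fun s _ d ↦
      if ∑ k, ENNReal.ofReal (MFMPGM.weight H i s d k / ∑ l, MFMPGM.weight H i s d l) = 1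
        then 0 else 1
    have hf : ∀ s k, Measurable (f s k) := fun s k ↦
      Measurable.ite ((Finset.measurable_sum _ fun k _ ↦ hκ s k) (measurableSet_singleton 1))
        measurable_const measurable_const
    have h0 : ∫⁻ ω, f (MFMPGM.partitionOf i ω) (MFMPGM.choiceOf i ω) (MFMPGM.dataOf i ω)
        ∂MFMPGM.model N L H = 0 := by
      rw [MFMPGM.lintegral_model hH hf]
      refine Finset.sum_eq_zero fun s _ ↦ ?_
      rw [lintegral_congr (g := fun _ ↦ 0), lintegral_zero]
      intro d
      rcases MFMPGM.jointWeight_eq_zero_or hH s d with h | ⟨-, hW⟩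
      · simp [h]
      · have hfd : ∀ o, f s o d = 0 := fun o ↦ if_pos (MFMPGM.sum_normalised_weight hH s d hW)
        simp [hfd]
    rw [lintegral_eq_zero_iff
      (MFMPGM.measurable_sigma_dom (MFMPGM.measurable_comp_state hf))] at h0
    filter_upwards [h0] with ω hω
    by_contra hne
    simp only [f, if_neg hne] at hω
    exact one_ne_zero hω
  -- The averaged integrand is again a function of partition, choice and data, constant in the
  -- choice. The joint formula therefore applies to both sides, and the weights are compared
  -- pointwise.
  · rw [MFMPGM.lintegral_model hH hf, MFMPGM.lintegral_model hH (f := fun s _ d ↦ ∑ k,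
      ENNReal.ofReal (MFMPGM.weight H i s d k / ∑ l, MFMPGM.weight H i s d l) * f s k d)
      fun s _ ↦ Finset.measurable_sum _ fun k _ ↦ (hκ s k).mul (hf s k)]
    refine Finset.sum_congr rfl fun s _ ↦ lintegral_congr fun d ↦ ?_
    rw [← Finset.sum_mul]
    congr 1
    rw [Finset.mul_sum]
    refine Finset.sum_congr rfl fun k _ ↦ ?_
    rw [← mul_assoc, MFMPGM.sum_jointWeight_mul hH]
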